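/- **Setup.** Let $(\,,\,)$ be the symmetric bilinear form on $\mathbb{C}^4$ with basis $\alpha_1,\dots,\alpha_4$ given by $(\alpha_i,\alpha_i)=2$ and $(\alpha_i,\alpha_j)=-2$ for $i\ne j$, and let $\omega_1,\dots,\omega_4$ be the dual basis. Let $W=\langle\sigma_1,\dots,\sigma_4\mid\sigma_i^2=1\rangle$ act by $\sigma_i(v)=v-(v,\alpha_i)\alpha_i$, let $W_3=\langle\sigma_2,\sigma_3,\sigma_4\rangle$, and let $\ell$ be the word length. Put $\rho=\tfrac12(\alpha_2+\alpha_3+\alpha_4)$, and let $$Z_3^-(\mathbf s)=\sum_{w\in W_3}(-1)^{\ell(w)}e^{-(w\mathbf c,\mathbf s)},$$ where $\mathbf c=c_1\alpha_1+\dots+c_4\alpha_4$ with real $c_i$ such that $c_2=c_3=c_4$ and $2c_1+2c_2=1$. Write $$\mathbf s=z_0\omega_1+z_1\tfrac{\alpha_3+\alpha_4}2+z_2\alpha_4+z_3\tfrac{\alpha_2+\alpha_4}2,\qquad Z=\begin{pmatrix}z_1&z_2\\z_2&z_3\end{pmatrix}.$$ Let $\Delta_5$ be the Gritsenko–Nikulin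 Siegel cusp form on the Siegel upper half plane $\mathbb H_2$, given by its Fourier expansion $$\tfrac1{64}\Delta_5\begin{pmatrix}\tau_1&\tau_2\\ \tau_2&\tau_3\end{pmatrix}=\sum_{\substack{n,l,m\ \mathrm{odd}\\ n,\,m,\,4mn-l^2>0}}\ \sum_{d\mid\gcd(n,l,m)}d^4\,g\!\left(\tfrac{mn}{d^2},\tfrac ld\right)e^{\pi i(n\tau_1+l\tau_2+m\tau_3)},$$ where $\sum_{k,l}g(k,l)e^{\pi i(k\tau+lz)}=\eta(\tau)^9\sum_{n\in\mathbb Z}(-1)^ne^{\pi i(2n+1)z+\pi i(n+1/2)^2\tau}$ and $\eta$ is the Dedekind eta function. **Theorem 3.1.** There are integers $m(\alpha)$, for $\alpha$ in the set of nonnegative integer combinations of $\alpha_2,\alpha_3,\alpha_4$ with $(\alpha,\alpha_i)\le0$ for $i=2,3,4$, and integers $q(\beta)$, for $\beta$ in the set of nonnegative integer combinations of $\alpha_2,\alpha_3,\alpha_4$, where $q(\beta)=0$ unless $(\beta,\beta)\le0$, such that the following holds for all $\mathbf c$ as above and all $z_0,z_1,z_2,z_3\in\mathbb C$. 1. If $\tfrac1{\pi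 i}Z\in\mathbb H_2$, then the Fourier series of $\Delta_5$ at $\tfrac1{\pi i}Z$, the series $Z_3^-(\mathbf s)$ and the double series over $\alpha$ and $w$ below converge absolutely, and $$e^{(\mathbf c,\mathbf s)}\Bigl(Z_3^-(\mathbf s)-\sum_\alpha m(\alpha)\sum_{w\in W_3}(-1)^{\ell(w)}e^{-(w(\mathbf c+\alpha),\mathbf s)}\Bigr)=\frac{e^{(\rho,\mathbf s)}}{64}\,\Delta_5\!\left(\tfrac1{\pi i}Z\right).$$ 2. The quotient is a series of exponentials $e^{-(\beta,\mathbf s)}$ with $(\beta,\beta)\le0$: $$\frac{e^{(\rho,\mathbf s)}\Delta_5\!\left(\tfrac1{\pi i}Z\right)}{64\,e^{(\mathbf c,\mathbf s)}Z_3^-(\mathbf s)}=\sum_\beta q(\beta)\,e^{-(\beta,\mathbf s)}$$ whenever $\tfrac1{\pi i}Z\in\mathbb H_2$, $Z_3^-(\mathbf s)\ne0$ and the series on the right converges absolutely. Moreover there is a real $R$, independent of $\mathbf c$, such that these three conditions hold for all $\mathbf s$ with $\operatorname{Re}(\alpha_i,\mathbf s)>R$ for $i=2,3,4$. -/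

import Mathlib

noncomputable section

namespace Apollonian

/-! ### The root system

The index set `{1, 2, 3, 4}` is `Fin 4`, with `i : Fin 4` standing for the index `i + 1`; so the
rank three subsystem on `α₂, α₃, α₄` has the indices `1, 2, 3 : Fin 4`.  Vectors are written in the
basis of simple roots: `v : Fin 4 → R` is `v 0 α₁ + v 1 α₂ + v 2 α₃ + v 3 α₄`. -/

/-- The Cartan matrix. -/
def cartan : Matrix (Fin 4) (Fin 4) ℤ :=
  !![2, -2, -2, -2; -2, 2, -2, -2; -2, -2, 2, -2; -2, -2, -2, 2]

/-- The symmetric bilinear form `( , )` given by the Cartan matrix, on `R⁴`.  It is used over `ℤ`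
(the root lattice) and over `ℂ` (the complexification of `ℝ⁴`). -/
def form {R : Type*} [CommRing R] (x y : Fin 4 → R) : R :=
  ∑ i, ∑ j, x i * (cartan i j : R) * y j

/-- The simple roots. -/
def α {R : Type*} [CommRing R] (i : Fin 4) : Fin 4 → R := Pi.single i 1

/-- The fundamental weights `ω_i = α_i / 4 - (α₁ + α₂ + α₃ + α₄) / 8`. -/
def ω (i : Fin 4) : Fin 4 → ℂ := (1 / 4 : ℂ) • α i - (1 / 8 : ℂ) • ∑ j, α j

/-- The fundamental weights are the basis dual to the simple roots. -/
theorem form_α_ω (i j : Fin 4) : form (α i) (ω j) = if i = j then 1 else 0 := by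
  fin_cases i <;> fin_cases j <;>
    simp [form, α, ω, cartan, Fin.sum_univ_four, Pi.single_apply] <;> norm_num

/-- The simple reflections `σ_i (v) = v - (v, α_i) α_i`. -/
def σ (i : Fin 4) : Module.End ℂ (Fin 4 → ℂ) where
  toFun v := v - form v (α i) • α i
  map_add' v w := by
    have : form (v + w) (α i) = form v (α i) + form w (α i) := by
      simp [form, add_mul, Finset.sum_add_distrib]
    rw [this]; module
  map_smul' a v := by
    have : form (a • v) (α i) = a * form v (α i) := by
      simp [form, Finset.mul_sum, mul_assoc]
    rw [this, RingHom.id_apply]; module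

theorem σ_mul_self (i : Fin 4) : σ i * σ i = 1 := by
  ext j k
  fin_cases i <;> fin_cases j <;> fin_cases k <;>
    simp [σ, form, α, cartan, Fin.sum_univ_four, Pi.single_apply] <;> norm_num

/-- The Coxeter matrix with all off-diagonal entries infinite (written `0` by convention), so that
its Coxeter group is `⟨σ₁, σ₂, σ₃, σ₄ | σ_i² = 1⟩`. -/
def coxeter : CoxeterMatrix (Fin 4) where
  M := Matrix.of fun i j => if i = j then 1 else 0
  isSymm := by ext i j; simp [eq_comm]
  diagonal i := by simp
  off_diagonal i j h := by simp [h]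

/-- The Weyl group `W = ⟨σ₁, σ₂, σ₃, σ₄ | σ_i² = 1⟩`, the Apollonian group. -/
abbrev W : Type := coxeter.Group

/-- `W` with its Coxeter generators. -/
abbrev cs : CoxeterSystem coxeter W := coxeter.toCoxeterSystem

theorem σ_isLiftable : coxeter.IsLiftable σ := by
  intro i j
  by_cases h : i = j
  · subst h; simp [coxeter, σ_mul_self]
  · simp [coxeter, h]

/-- The action of `W` on `ℂ⁴`, in which the generators act by the simple reflections. -/
def act : W →* Module.End ℂ (Fin 4 → ℂ) := cs.lift ⟨σ, σ_isLiftable⟩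

/-- The subgroup `W₃ = ⟨σ₂, σ₃, σ₄⟩`. -/
def W₃ : Subgroup W := Subgroup.closure {cs.simple 1, cs.simple 2, cs.simple 3}

/-- `(-1)^ℓ(w)`, where `ℓ(w)` is the length of a reduced word for `w`. -/
def sgn (w : W) : ℂ := (-1) ^ cs.length w

/-- The summand `(-1)^ℓ(w) e^{-(w v, s)}`. -/
def altTerm (v s : Fin 4 → ℂ) (w : W) : ℂ := sgn w * Complex.exp (-form (act w v) s)

/-- The alternating sum `∑_{w ∈ W₃} (-1)^ℓ(w) e^{-(w v, s)}`; for `v = c` it is `Z₃⁻(s)`. -/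
def altSum (v s : Fin 4 → ℂ) : ℂ := ∑' w : W₃, altTerm v s w

/-- The element `a 0 α₂ + a 1 α₃ + a 2 α₄` of the root lattice. -/
def rootVec (a : Fin 3 → ℕ) : Fin 4 → ℤ := ![0, a 0, a 1, a 2]

/-- Root lattice vectors as vectors of `ℂ⁴`. -/
def toC (v : Fin 4 → ℤ) : Fin 4 → ℂ := fun i => v i

/-- The nonnegative integer combinations `α` of `α₂, α₃, α₄` such that `(α, α_i) ≤ 0` for
`i = 2, 3, 4`. -/
def Antidominant : Type :=
  {a : Fin 3 → ℕ // ∀ i : Fin 3, form (rootVec a) (α i.succ) ≤ 0}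

/-- `ρ = (α₂ + α₃ + α₄) / 2`. -/
def ρ : Fin 4 → ℂ := (1 / 2 : ℂ) • (α 1 + α 2 + α 3)

/-- The vector `z₀ ω₁ + z₁ β₁ + z₂ β₂ + z₃ β₃`, where `β₁ = (α₃ + α₄) / 2`, `β₂ = α₄` and
`β₃ = (α₂ + α₄) / 2`. -/
def sVec (z₀ z₁ z₂ z₃ : ℂ) : Fin 4 → ℂ :=
  z₀ • ω 0 + z₁ • ((1 / 2 : ℂ) • (α 2 + α 3)) + z₂ • α 3 + z₃ • ((1 / 2 : ℂ) • (α 1 + α 3))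

/-! ### The Siegel modular form `Δ₅` -/

/-- The Siegel upper half plane `ℍ₂`. -/
def siegelH : Set (Matrix (Fin 2) (Fin 2) ℂ) :=
  {Z | Z.IsSymm ∧ (Z.map Complex.im).PosDef}

/-- `θ₁₁(z, τ) = ∑_{n ∈ ℤ} (-1)^n e^{π i (2n+1) z + π i (n + 1/2)² τ}`. -/
def theta11 (z τ : ℂ) : ℂ :=
  ∑' n : ℤ, (-1 : ℂ) ^ n * Complex.exp
    (Real.pi * Complex.I * (2 * n + 1) * z + Real.pi * Complex.I * (n + 1 / 2) ^ 2 * τ)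

/-- The coefficient of `q^N` in `∏_{j ≥ 1} (1 - q^j)^9`; the factors with `j > N` do not
contribute. -/
def eta9Coeff (N : ℕ) : ℤ :=
  (∏ j ∈ Finset.range N, (1 - Polynomial.X ^ (j + 1) : Polynomial ℤ) ^ 9).coeff N

/-- The coefficient `g(k, l)` of `e^{π i (k z₁ + l z₂)}` in `η(z₁)^9 θ₁₁(z₂, z₁)`: the product of
the term of `η^9` of exponent `3/4 + 2N` with the term of `θ₁₁` of exponent `l²/4`, where `l` is odd
and `k = 3/4 + l²/4 + 2N`.  See `hasSum_g`. -/
def g (k l : ℤ) : ℤ :=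
  if Odd l ∧ 0 ≤ 4 * k - l ^ 2 - 3 ∧ 8 ∣ 4 * k - l ^ 2 - 3 then
    ((l - 1) / 2).negOnePow * eta9Coeff ((4 * k - l ^ 2 - 3) / 8).toNat
  else 0

open Filter Topology in
/-- If polynomials converge locally uniformly on the unit disc and each coefficient is eventually
constant, the limit is the power series of these coefficients. -/
theorem hasSum_of_poly_tendsto (P : ℕ → Polynomial ℂ) (f : ℂ → ℂ) (a : ℕ → ℂ)
    (h : TendstoLocallyUniformlyOn (fun n x => (P n).eval x) f atTop (Metric.ball 0 1))
    (ha : ∀ k, ∀ n, k ≤ n → (P n).coeff k = a k) {x : ℂ} (hx : ‖x‖ < 1) :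
    HasSum (fun k => a k * x ^ k) (f x) := by
  have hd : DifferentiableOn ℂ f (Metric.ball 0 1) :=
    h.differentiableOn (Eventually.of_forall fun n => (P n).differentiable.differentiableOn)
      Metric.isOpen_ball
  have hk : ∀ k : ℕ, TendstoLocallyUniformlyOn
      (fun n x => (Polynomial.derivative^[k] (P n)).eval x) (iteratedDeriv k f) atTop
      (Metric.ball 0 1) := by
    intro k
    induction k with
    | zero => simpa using h
    | succ k ih =>
      have := ih.deriv (Eventually.of_forall fun n =>
        (Polynomial.differentiable _).differentiableOn) Metric.isOpen_ball
      rw [iteratedDeriv_succ]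
      refine this.congr fun n y _ => ?_
      simp [Function.iterate_succ_apply']
  have hval : ∀ k, iteratedDeriv k f 0 = (k.factorial : ℂ) * a k := by
    intro k
    have h1 := (hk k).tendsto_at (Metric.mem_ball_self one_pos)
    refine tendsto_nhds_unique h1 (tendsto_const_nhds.congr' ?_)
    filter_upwards [eventually_ge_atTop k] with n hn
    rw [← Polynomial.coeff_zero_eq_eval_zero, Polynomial.coeff_iterate_derivative, zero_add,
      ha k n hn, Nat.descFactorial_self, nsmul_eq_mul]
  have := Complex.hasSum_taylorSeries_on_ball hd (z := x) (by simpa using hx)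
  refine this.congr_fun ?_
  intro k
  have hf : (k.factorial : ℂ) ≠ 0 := by exact_mod_cast k.factorial_ne_zero
  simp only [sub_zero, smul_eq_mul, hval]
  field_simp

theorem coeff_prod_eq (k n : ℕ) (h : k ≤ n) :
    (∏ j ∈ Finset.range n, (1 - Polynomial.X ^ (j + 1) : Polynomial ℤ) ^ 9).coeff k =
      eta9Coeff k := by
  induction n, h using Nat.le_induction with
  | base => rfl
  | succ n h ih =>
    obtain ⟨r, hr⟩ : (Polynomial.X ^ (n + 1) : Polynomial ℤ) ∣
        (1 - (1 - Polynomial.X ^ (n + 1)) ^ 9) := by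
      have := sub_dvd_pow_sub_pow (1 : Polynomial ℤ) (1 - Polynomial.X ^ (n + 1)) 9
      rwa [one_pow, sub_sub_cancel] at this
    rw [Finset.prod_range_succ, show (1 - Polynomial.X ^ (n + 1) : Polynomial ℤ) ^ 9 =
      1 - Polynomial.X ^ (n + 1) * r by rw [← hr]; ring, mul_sub, mul_one, Polynomial.coeff_sub, ih,
      mul_left_comm, Polynomial.coeff_X_pow_mul', if_neg (by omega), sub_zero]

open Filter Topology in
/-- `∏_{j ≥ 1} (1 - x^j)^9 = ∑ eta9Coeff N x^N`. -/
theorem hasSum_eta9Coeff {x : ℂ} (hx : ‖x‖ < 1) :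
    HasSum (fun N => (eta9Coeff N : ℂ) * x ^ N) ((∏' j : ℕ, (1 - x ^ (j + 1))) ^ 9) := by
  have h1 := ModularForm.multipliableLocallyUniformlyOn_one_sub_pow.hasProdLocallyUniformlyOn
    |>.tendstoLocallyUniformlyOn_finsetRange
  have hc := ModularForm.differentiableOn_tprod_one_sub_pow.continuousOn
  have h9 : ∀ k : ℕ, TendstoLocallyUniformlyOn
      (fun (n : ℕ) (x : ℂ) => (∏ j ∈ Finset.range n, (1 - x ^ (j + 1))) ^ k)
      (fun x => (∏' j : ℕ, (1 - x ^ (j + 1))) ^ k) atTop (Metric.ball 0 1) := by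
    intro k
    induction k with
    | zero =>
      simp only [pow_zero]
      exact fun u hu x _ => ⟨Set.univ, univ_mem, Eventually.of_forall fun n y _ => refl_mem_uniformity hu⟩
    | succ k ih =>
      simp only [pow_succ]
      exact ih.fun_mul₀ h1 (hc.pow k) hc
  refine hasSum_of_poly_tendsto
    (fun n => (∏ j ∈ Finset.range n, (1 - Polynomial.X ^ (j + 1) : Polynomial ℤ) ^ 9).map
      (Int.castRingHom ℂ)) (fun x => (∏' j : ℕ, (1 - x ^ (j + 1))) ^ 9)
    (fun N => (eta9Coeff N : ℂ)) ?_ ?_ hx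
  · refine (h9 9).congr fun n y _ => ?_
    simp [Polynomial.map_prod, Polynomial.eval_prod, Finset.prod_pow]
  · intro k n h
    rw [Polynomial.coeff_map, coeff_prod_eq k n h]; simp

/-- The series of `θ₁₁` converges absolutely. -/
theorem hasSum_theta11 (z : ℂ) {τ : ℂ} (hτ : 0 < τ.im) :
    HasSum (fun n : ℤ => (-1 : ℂ) ^ n * Complex.exp
      (Real.pi * Complex.I * (2 * n + 1) * z + Real.pi * Complex.I * (n + 1 / 2) ^ 2 * τ))
      (theta11 z τ) := by
  refine Summable.hasSum ?_
  have h := ((summable_jacobiTheta₂_term_iff (z + τ / 2 + 1 / 2) τ).2 hτ).mul_left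
    (Complex.exp (Real.pi * Complex.I * (z + τ / 4)))
  refine h.congr fun n => ?_
  have h1 : (-1 : ℂ) ^ n = Complex.exp (n * (Real.pi * Complex.I)) := by
    rw [Complex.exp_int_mul, Complex.exp_pi_mul_I]
  rw [jacobiTheta₂_term, h1, ← Complex.exp_add, ← Complex.exp_add]
  congr 1
  ring

theorem exists_of_g_ne_zero {k l : ℤ} (h : g k l ≠ 0) :
    ∃ (N : ℕ) (n : ℤ), k = n ^ 2 + n + 1 + 2 * N ∧ l = 2 * n + 1 := by
  rw [g] at h
  obtain ⟨⟨⟨n, hn⟩, h0, N, hN⟩, -⟩ := ite_ne_right_iff.1 h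
  lift N to ℕ using by omega
  refine ⟨N, n, ?_, hn⟩
  rw [hn] at hN
  linarith

/-- The exponents `(k, l)` that occur in the generating series. -/
def expPair (p : ℕ × ℤ) : ℤ × ℤ := (p.2 ^ 2 + p.2 + 1 + 2 * p.1, 2 * p.2 + 1)

theorem expPair_injective : Function.Injective expPair := by
  rintro ⟨N, n⟩ ⟨N', n'⟩ h
  simp only [expPair, Prod.mk.injEq] at h
  obtain ⟨h1, h2⟩ := h
  obtain rfl : n = n' := by omega
  simp only [Prod.mk.injEq, and_true]
  omega

theorem g_term (z₁ z₂ : ℂ) (N : ℕ) (n : ℤ) :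
    (g (n ^ 2 + n + 1 + 2 * (N : ℤ)) (2 * n + 1) : ℂ) * Complex.exp (Real.pi * Complex.I *
        (((n ^ 2 + n + 1 + 2 * (N : ℤ) : ℤ) : ℂ) * z₁ + ((2 * n + 1 : ℤ) : ℂ) * z₂)) =
      Complex.exp (3 / 4 * (Real.pi * Complex.I * z₁)) *
        ((eta9Coeff N : ℂ) * Complex.exp (2 * Real.pi * Complex.I * z₁) ^ N) *
        ((-1 : ℂ) ^ n * Complex.exp (Real.pi * Complex.I * (2 * n + 1) * z₂ +
          Real.pi * Complex.I * (n + 1 / 2) ^ 2 * z₁)) := by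
  have e1 : (4 * (n ^ 2 + n + 1 + 2 * (N : ℤ)) - (2 * n + 1) ^ 2 - 3) = 8 * N := by ring
  have e2 : g (n ^ 2 + n + 1 + 2 * (N : ℤ)) (2 * n + 1) = n.negOnePow * eta9Coeff N := by
    rw [g, e1, if_pos ⟨⟨n, rfl⟩, by positivity, dvd_mul_right _ _⟩]
    congr 2
    · congr 1; omega
    · omega
  have e3 : (((n.negOnePow : ℤˣ) : ℤ) : ℂ) = (-1 : ℂ) ^ n := by
    rcases Int.even_or_odd n with h | h
    · rw [Int.negOnePow_even n h, h.neg_one_zpow]; simp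
    · rw [Int.negOnePow_odd n h, h.neg_one_zpow]; simp
  rw [e2, Int.cast_mul, e3]
  have e4 : Complex.exp (2 * Real.pi * Complex.I * z₁) ^ N = Complex.exp (N * (2 * Real.pi * Complex.I * z₁)) := by
    rw [Complex.exp_nat_mul]
  rw [e4]
  rw [show Complex.exp (Real.pi * Complex.I *
      (((n ^ 2 + n + 1 + 2 * (N : ℤ) : ℤ) : ℂ) * z₁ + ((2 * n + 1 : ℤ) : ℂ) * z₂)) =
      Complex.exp (3 / 4 * (Real.pi * Complex.I * z₁)) *
      Complex.exp (N * (2 * Real.pi * Complex.I * z₁)) *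
      Complex.exp (Real.pi * Complex.I * (2 * n + 1) * z₂ +
        Real.pi * Complex.I * (n + 1 / 2) ^ 2 * z₁) by
    rw [← Complex.exp_add, ← Complex.exp_add]
    congr 1
    push_cast
    ring]
  ring

/-- The generating series of the `g(k, l)`. -/
theorem hasSum_g {z₁ : ℂ} (h₁ : 0 < z₁.im) (z₂ : ℂ) :
    HasSum (fun p : ℤ × ℤ => (g p.1 p.2 : ℂ) *
        Complex.exp (Real.pi * Complex.I * (p.1 * z₁ + p.2 * z₂)))
      (ModularForm.eta z₁ ^ 9 * theta11 z₂ z₁) := by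
  set x : ℂ := Complex.exp (2 * Real.pi * Complex.I * z₁) with hx
  have hx1 : ‖x‖ < 1 := UpperHalfPlane.norm_exp_two_pi_I_lt_one ⟨z₁, h₁⟩
  have hE := hasSum_eta9Coeff hx1
  have hη : ModularForm.eta z₁ ^ 9 =
      Complex.exp (3 / 4 * (Real.pi * Complex.I * z₁)) * (∏' j : ℕ, (1 - x ^ (j + 1))) ^ 9 := by
    simp only [ModularForm.eta, ModularForm.eta_q_eq_pow, mul_pow, ← hx]
    congr 1
    rw [Function.Periodic.qParam, ← Complex.exp_nat_mul]
    congr 1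
    push_cast; ring
  have hT := hasSum_theta11 z₂ h₁
  have hE' := hE.mul_left (Complex.exp (3 / 4 * (Real.pi * Complex.I * z₁)))
  rw [← hη] at hE'
  have hs := summable_mul_of_summable_norm hE'.summable.norm hT.summable.norm
  have hprod := hE'.mul hT hs
  have hcomp := hprod.congr_fun (g := (fun p : ℤ × ℤ => (g p.1 p.2 : ℂ) *
    Complex.exp (Real.pi * Complex.I * (p.1 * z₁ + p.2 * z₂))) ∘ expPair)
    (fun p => g_term z₁ z₂ p.1 p.2)
  refine (expPair_injective.hasSum_iff ?_).1 hcomp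
  rintro ⟨k, l⟩ hkl
  have h0 : g k l = 0 := by
    by_contra h
    obtain ⟨N, n, rfl, rfl⟩ := exists_of_g_ne_zero h
    exact hkl ⟨(N, n), rfl⟩
  simp only [h0, Int.cast_zero, zero_mul]

/-- The Fourier coefficient `∑_{d ∣ gcd(l, m, n)} d⁴ g(mn/d², l/d)`. -/
def deltaCoeff (n l m : ℤ) : ℤ :=
  ∑ d ∈ (Nat.gcd (Int.gcd l m) n.natAbs).divisors, (d : ℤ) ^ 4 * g (m * n / (d : ℤ) ^ 2) (l / d)

/-- The triples `(n, l, m)` of odd integers with `m, n, 4mn - l² > 0`. -/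
def DeltaIndex : Type :=
  {p : ℤ × ℤ × ℤ // Odd p.1 ∧ Odd p.2.1 ∧ Odd p.2.2 ∧
    0 < p.2.2 ∧ 0 < p.1 ∧ 0 < 4 * p.2.2 * p.1 - p.2.1 ^ 2}

/-- The term of index `(n, l, m)` in the Fourier expansion of `Δ₅ / 64` at
`Z = (z₁, z₂; z₂, z₃)`. -/
def deltaTerm (Z : Matrix (Fin 2) (Fin 2) ℂ) (p : DeltaIndex) : ℂ :=
  (deltaCoeff p.1.1 p.1.2.1 p.1.2.2 : ℂ) * Complex.exp (Real.pi * Complex.I *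
    (p.1.1 * Z 0 0 + p.1.2.1 * Z 0 1 + p.1.2.2 * Z 1 1))

/-- The Gritsenko–Nikulin form `Δ₅` on `ℍ₂`, by its Fourier expansion. -/
def Delta5 (Z : Matrix (Fin 2) (Fin 2) ℂ) : ℂ := 64 * ∑' p : DeltaIndex, deltaTerm Z p

end Apollonian

end

noncomputable section

namespace Apollonian

open scoped Matrix

/-! ### Coefficients of the ninth power of the eta function -/

/-! The conditions on `c` say exactly that `(c, α_i) = -1 = (ρ, α_i)` for the three roots, so `c -
ρ` is fixed by `W₃` and the factor `e^{(c,s)}` turns `e^{-(w(c+a),s)}` into `e^{-(b,s)}` with `b =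
w(ρ+a) - ρ`. Everything becomes a statement about integer coefficients on `ℤ³` under this shifted
(dot) action, and `m` and `q` do not depend on `c`.

First statement. Setting `n = 2b₀+1`, `m = 2b₁+1`, `l = 2(b₀+b₁-b₂)+1` identifies the Fourier
indices of `Δ₅` with the vectors of `PosCone`, and `4mn - l² = -2(ρ+b, ρ+b)` (`posConeEquiv`). On
this set `W₃` acts freely with the antidominant vectors as fundamental domain (`chamberEquiv`). Each
reflection negates the Fourier coefficients (`fourierCoeff_dotRefl`), so the expansion is a
combination of alternating sums over `W₃`. The one at `a = 0` has coefficient 1 and is `Z₃⁻`; the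
others define `m`. The rearrangement is justified by polynomial growth of the coefficients against
linear growth of the exponents on the cone (`summable_mul_latticeExp`).

Second statement. The coefficients `q` come from formal division. Numerator and denominator are
antisymmetric under the dot action, so `q` is invariant under the linear action
(`quotient_latticeRefl`). A vector of its support can then be reflected down to an antidominant one,
where `(β, β) = ∑ β_i (β, α_i) ≤ 0` (`norm_nonpos_of_invariant`). An exponential bound on `q` gives
convergence far inside the cone. -/

/-- Cauchy's estimate for the coefficients of a power series convergent on the unit disc. -/
theorem norm_powerSeries_coeff_mul_pow_le {a : ℕ → ℂ} {F : ℂ → ℂ}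
    (hF : ∀ x, ‖x‖ < 1 → HasSum (fun k => a k * x ^ k) (F x)) {r C : ℝ} (hr : 0 < r)
    (hr1 : r < 1) (hC : ∀ x, ‖x‖ = r → ‖F x‖ ≤ C) (n : ℕ) : ‖a n‖ * r ^ n ≤ C := by
  have hball : Metric.eball (0 : ℂ) 1 = Metric.ball 0 1 := by
    rw [← ENNReal.ofReal_one, Metric.eball_ofReal]
  have hp : HasFPowerSeriesOnBall F (FormalMultilinearSeries.ofScalars ℂ a) 0 1 := by
    refine ⟨?_, one_pos, ?_⟩
    · refine ENNReal.le_of_forall_nnreal_lt fun t ht => ?_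
      have ht' : ‖((t : ℝ) : ℂ)‖ < 1 := by simpa using ht
      refine FormalMultilinearSeries.le_radius_of_summable_norm _ ?_
      refine (hF _ ht').summable.norm.congr fun k => ?_
      simp
    · intro y hy
      have hy' : ‖y‖ < 1 := by rwa [hball, mem_ball_zero_iff] at hy
      rw [zero_add]
      refine (hF _ hy').congr_fun fun k => ?_
      simp [mul_comm]
  have hd : DiffContOnCl ℂ F (Metric.ball 0 r) := by
    refine DifferentiableOn.diffContOnCl ?_
    refine hp.differentiableOn.mono ?_
    rw [closure_ball _ hr.ne']
    intro x hx
    have : ‖x‖ < 1 := lt_of_le_of_lt (by simpa using hx) hr1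
    rwa [hball, mem_ball_zero_iff]
  have h1 := Complex.norm_iteratedDeriv_le_of_forall_mem_sphere_norm_le n hr hd
    (C := C) (fun z hz => hC z (by simpa using hz))
  have h2 : iteratedDeriv n F 0 = n.factorial * a n := by
    have := hp.factorial_smul 1 n
    rw [iteratedDeriv_eq_iteratedFDeriv, ← this]
    simp
  rw [h2] at h1
  have hn : (0 : ℝ) < n.factorial := by positivity
  rw [norm_mul, Complex.norm_natCast, mul_div_assoc] at h1
  have := le_of_mul_le_mul_left h1 hn
  rwa [le_div_iff₀ (by positivity)] at this

-- The 24th power of `η` is a cusp form of weight 12, hence bounded by a multiple of `y^(-6)`. Its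
-- power 3/8 gives `y^(-9/4)`, and `y ≤ 1` allows the integer exponent 3.
open ModularForm in
theorem exists_norm_eta_pow_nine_le :
    ∃ C : ℝ, 0 < C ∧ ∀ τ : ℂ, 0 < τ.im → τ.im ≤ 1 → ‖eta τ ^ 9‖ ≤ C / τ.im ^ 3 := by
  obtain ⟨C, hC⟩ := CuspFormClass.exists_bound CuspForm.discriminant
  refine ⟨max C 1, by positivity, fun τ h0 h1 => ?_⟩
  have h := hC ⟨τ, h0⟩
  rw [CuspForm.coe_discriminant, discriminant] at h
  have e6 : ((12 : ℤ) / 2 : ℝ) = (6 : ℕ) := by norm_num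
  rw [e6, Real.rpow_natCast] at h
  change ‖eta τ ^ 24‖ ≤ C / τ.im ^ 6 at h
  have hC1 : (1 : ℝ) ≤ max C 1 := le_max_right _ _
  have h' : ‖eta τ ^ 24‖ ≤ max C 1 / τ.im ^ 6 := h.trans (by gcongr; exact le_max_left _ _)
  -- Comparing eighth powers avoids fractional exponents: `9 · 8 = 24 · 3`.
  refine le_of_pow_le_pow_left₀ (n := 8) (by norm_num) (by positivity) ?_
  rw [norm_pow] at h' ⊢
  calc (‖eta τ‖ ^ 9) ^ 8 = (‖eta τ‖ ^ 24) ^ 3 := by ring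
    _ ≤ (max C 1 / τ.im ^ 6) ^ 3 := by gcongr
    _ = max C 1 ^ 3 / τ.im ^ 18 := by rw [div_pow, ← pow_mul]
    _ ≤ max C 1 ^ 8 / τ.im ^ 24 := by
      gcongr ?_ / ?_
      · exact pow_le_pow_right₀ hC1 (by norm_num)
      · exact pow_le_pow_of_le_one h0.le h1 (by norm_num)
    _ = _ := by rw [div_pow, ← pow_mul]

/-- The coefficients of `∏ (1 - q^j)^9` grow at most polynomially. -/
theorem exists_abs_eta9Coeff_le :
    ∃ C : ℝ, 0 < C ∧ ∀ N : ℕ, |(eta9Coeff N : ℝ)| ≤ C * (N + 1) ^ 3 := by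
  obtain ⟨C, hC0, hC⟩ := exists_norm_eta_pow_nine_le
  refine ⟨C * Real.exp Real.pi * Real.exp (2 * Real.pi), by positivity, fun N => ?_⟩
  have hN : (0 : ℝ) < N + 1 := by positivity
  -- Cauchy's estimate is used on the circle of radius `r = e^(-2πy)`: there `r^(-N) ≤ e^(2π)`,
  -- while the bound on `η^9` is cubic in `N + 1`.
  set y : ℝ := 1 / (N + 1) with hy
  have hy0 : 0 < y := by positivity
  have hy1 : y ≤ 1 := by rw [hy, div_le_one hN]; linarith [(Nat.cast_nonneg N : (0:ℝ) ≤ N)]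
  have hr1 : Real.exp (-(2 * Real.pi * y)) < 1 := by
    rw [Real.exp_lt_one_iff]; have := Real.pi_pos; simp; positivity
  have key := norm_powerSeries_coeff_mul_pow_le (a := fun N => (eta9Coeff N : ℂ))
    (fun x hx => hasSum_eta9Coeff hx) (Real.exp_pos _) hr1
    (C := C * Real.exp Real.pi * (N + 1) ^ 3) (fun x hx => ?_) N
  · have e1 : Real.exp (-(2 * Real.pi * y)) ^ N * Real.exp (2 * Real.pi) ≥ 1 := by
      rw [← Real.exp_nat_mul, ← Real.exp_add, ge_iff_le, Real.one_le_exp_iff]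
      have : N * y ≤ 1 := by rw [hy, mul_one_div, div_le_one hN]; linarith
      nlinarith [Real.pi_pos]
    have e2 : ‖(eta9Coeff N : ℂ)‖ = |(eta9Coeff N : ℝ)| := by simp
    rw [e2] at key
    calc |(eta9Coeff N : ℝ)| ≤ |(eta9Coeff N : ℝ)| *
          (Real.exp (-(2 * Real.pi * y)) ^ N * Real.exp (2 * Real.pi)) :=
          le_mul_of_one_le_right (abs_nonneg _) e1
      _ = (|(eta9Coeff N : ℝ)| * Real.exp (-(2 * Real.pi * y)) ^ N) * Real.exp (2 * Real.pi) := by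
          ring
      _ ≤ (C * Real.exp Real.pi * (N + 1) ^ 3) * Real.exp (2 * Real.pi) := by gcongr
      _ = _ := by ring
  · have hx0 : x ≠ 0 := by rintro rfl; simp at hx; exact absurd hx (Real.exp_pos _).ne
    set τ : ℂ := Complex.log x / (2 * Real.pi * Complex.I) with hτ
    have hI : (2 * Real.pi * Complex.I : ℂ) ≠ 0 := Complex.two_pi_I_ne_zero
    have hxτ : x = Complex.exp (2 * Real.pi * Complex.I * τ) := by
      rw [hτ, mul_div_cancel₀ _ hI, Complex.exp_log hx0]
    have him : τ.im = y := by
      have := congrArg Norm.norm hxτ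
      rw [hx, Complex.norm_exp, Real.exp_eq_exp] at this
      simp at this
      exact this.symm
    have hb := hC τ (him ▸ hy0) (him ▸ hy1)
    -- The prefactor is `q^(9/24)`. Its modulus is at least `e^(-π)`, which accounts for the factor
    -- `e^π` in the constant.
    have hη : ModularForm.eta τ ^ 9 =
        Complex.exp (3 / 4 * (Real.pi * Complex.I * τ)) * (∏' j : ℕ, (1 - x ^ (j + 1))) ^ 9 := by
      simp only [ModularForm.eta, ModularForm.eta_q_eq_pow, mul_pow, hxτ]
      congr 1
      rw [Function.Periodic.qParam, ← Complex.exp_nat_mul]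
      congr 1
      push_cast; ring
    rw [hη, norm_mul, Complex.norm_exp, him] at hb
    have e3 : (3 / 4 * (Real.pi * Complex.I * τ)).re = -(3 / 4 * Real.pi * y) := by
      have : (3 / 4 * (Real.pi * Complex.I * τ) : ℂ) =
          ((3 / 4 * Real.pi : ℝ) : ℂ) * (Complex.I * τ) := by push_cast; ring
      rw [this, Complex.re_ofReal_mul]; simp [him]
    rw [e3] at hb
    have e4 : 1 ≤ Real.exp (-(3 / 4 * Real.pi * y)) * Real.exp Real.pi := by
      rw [← Real.exp_add, Real.one_le_exp_iff]; nlinarith [Real.pi_pos]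
    have e5 : C / y ^ 3 = C * (N + 1) ^ 3 := by rw [hy]; field_simp
    rw [e5] at hb
    set P := ‖(∏' j : ℕ, (1 - x ^ (j + 1))) ^ 9‖
    calc P ≤ P * (Real.exp (-(3 / 4 * Real.pi * y)) * Real.exp Real.pi) :=
          le_mul_of_one_le_right (norm_nonneg _) e4
      _ = (Real.exp (-(3 / 4 * Real.pi * y)) * P) * Real.exp Real.pi := by ring
      _ ≤ (C * (N + 1) ^ 3) * Real.exp Real.pi := by gcongr
      _ = _ := by ring

/-! ### The dot action of `W₃` on the root lattice of rank three -/

/-- The pairing of `b 0 α₂ + b 1 α₃ + b 2 α₄` with the `i`-th of the roots `α₂, α₃, α₄`. -/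
def pairing (b : Fin 3 → ℤ) (i : Fin 3) : ℤ := 4 * b i - 2 * ∑ j, b j

/-- The reflection `σ_i` shifted by `ρ`, that is `b ↦ σ_i (ρ + b) - ρ`. -/
def dotRefl (i : Fin 3) (b : Fin 3 → ℤ) : Fin 3 → ℤ :=
  Function.update b i (b i + 1 - pairing b i)

theorem dotRefl_dotRefl (i : Fin 3) (b : Fin 3 → ℤ) : dotRefl i (dotRefl i b) = b := by
  ext j
  fin_cases i <;> fin_cases j <;> simp [dotRefl, pairing, Fin.sum_univ_three] <;> ring

theorem pairing_dotRefl_self (i : Fin 3) (b : Fin 3 → ℤ) :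
    pairing (dotRefl i b) i = 2 - pairing b i := by
  fin_cases i <;> simp [dotRefl, pairing, Fin.sum_univ_three] <;> ring

theorem pairing_dotRefl_of_ne {i j : Fin 3} (h : j ≠ i) (b : Fin 3 → ℤ) :
    pairing (dotRefl i b) j = pairing b j + 2 * pairing b i - 2 := by
  fin_cases i <;> fin_cases j <;> simp at h <;>
    simp [dotRefl, pairing, Fin.sum_univ_three] <;> ring

theorem sum_dotRefl (i : Fin 3) (b : Fin 3 → ℤ) :
    ∑ j, dotRefl i b j = ∑ j, b j + 1 - pairing b i := by
  fin_cases i <;> simp [dotRefl, pairing, Fin.sum_univ_three] <;> ring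

/-- The pairing is even, so `(ρ + b, α_i) = pairing b i - 1` never vanishes: no shifted lattice
vector lies on a wall. -/
theorem pairing_ne_one (b : Fin 3 → ℤ) (i : Fin 3) : pairing b i ≠ 1 := by
  rw [pairing]; omega

/-- `-2 (v, v)` for `v = ρ + b`. -/
def disc (b : Fin 3 → ℤ) : ℤ := (∑ i, (2 * b i + 1)) ^ 2 - 2 * ∑ i, (2 * b i + 1) ^ 2

/-- The vectors `b` for which `ρ + b` lies in the positive cone of the Lorentzian form. -/
def PosCone (b : Fin 3 → ℤ) : Prop := 0 ≤ b ∧ 0 < disc b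

theorem disc_dotRefl (i : Fin 3) (b : Fin 3 → ℤ) : disc (dotRefl i b) = disc b := by
  fin_cases i <;> simp [disc, dotRefl, pairing, Fin.sum_univ_three] <;> ring

theorem PosCone.dotRefl {b : Fin 3 → ℤ} (h : PosCone b) (i : Fin 3) : PosCone (dotRefl i b) := by
  obtain ⟨h0, hd⟩ := h
  refine ⟨fun j => ?_, by rwa [disc_dotRefl]⟩
  have h00 : 0 ≤ b 0 := h0 0
  have h01 : 0 ≤ b 1 := h0 1
  have h02 : 0 ≤ b 2 := h0 2
  by_cases hj : j = i
  · subst hj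
    -- Vieta: with `x_i = 2 b i + 1`, the old and new `x_j` are the two roots of one monic
    -- quadratic, with product `disc b + (x_k - x_l)²` for the other two indices `k`, `l`.
    have key : (2 * Apollonian.dotRefl j b j + 1) * (2 * b j + 1) > 0 := by
      simp only [disc, Fin.sum_univ_three] at hd
      fin_cases j <;> simp [Apollonian.dotRefl, pairing, Fin.sum_univ_three]
      · nlinarith [sq_nonneg (b 1 - b 2)]
      · nlinarith [sq_nonneg (b 0 - b 2)]
      · nlinarith [sq_nonneg (b 0 - b 1)]
    have hj0 : 0 ≤ b j := h0 j
    have := pos_of_mul_pos_left key (by linarith)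
    change 0 ≤ Apollonian.dotRefl j b j
    omega
  · rw [Apollonian.dotRefl, Function.update_of_ne hj]; exact h0 j

/-- The dot reflection as a permutation. -/
def dotReflPerm (i : Fin 3) : Equiv.Perm (Fin 3 → ℤ) :=
  ⟨dotRefl i, dotRefl i, dotRefl_dotRefl i, dotRefl_dotRefl i⟩

theorem isLiftable_of_involutive {G : Type*} [Monoid G] (f : Fin 4 → G) (h : ∀ i, f i * f i = 1) :
    coxeter.IsLiftable f := by
  intro i j
  by_cases hij : i = j
  · subst hij; simp [coxeter, h]
  · simp [coxeter, hij]

/-- The dot action on the lattice spanned by `α₂, α₃, α₄`, extended to `W` by letting `σ₁` act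
trivially. -/
def dot : W →* Equiv.Perm (Fin 3 → ℤ) :=
  cs.lift ⟨Fin.cons 1 dotReflPerm, isLiftable_of_involutive _ (by
    intro i
    refine Fin.cases ?_ (fun i => ?_) i
    · simp
    · ext1 b; exact dotRefl_dotRefl i b)⟩

@[simp]
theorem dot_simple (i : Fin 3) (b : Fin 3 → ℤ) : dot (cs.simple i.succ) b = dotRefl i b := by
  simp only [dot, CoxeterSystem.lift_apply_simple, Fin.cons_succ]
  rfl

/-- The sign character of `W`. -/
def signHom : W →* ℤˣ := cs.lift ⟨fun _ => -1, isLiftable_of_involutive _ (by simp)⟩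

@[simp]
theorem signHom_simple (i : Fin 4) : signHom (cs.simple i) = -1 := by
  rw [signHom, CoxeterSystem.lift_apply_simple]

theorem signHom_eq (w : W) : signHom w = (-1) ^ cs.length w := by
  obtain ⟨L, hL, rfl⟩ := cs.exists_isReduced w
  rw [hL.eq, CoxeterSystem.wordProd, map_list_prod, List.map_map]
  have : (signHom ∘ cs.simple : Fin 4 → ℤˣ) = fun _ => -1 := funext fun i => signHom_simple i
  rw [this]; simp

theorem sgn_eq (w : W) : sgn w = ((signHom w : ℤ) : ℂ) := by
  rw [signHom_eq, sgn]; simp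

theorem simple_succ_mem (i : Fin 3) : cs.simple i.succ ∈ W₃ := by
  refine Subgroup.subset_closure ?_
  fin_cases i <;> simp

/-- Induction on `W₃` by left multiplication by the generators. -/
theorem W₃_induction {p : W → Prop} (h1 : p 1)
    (hm : ∀ i : Fin 3, ∀ w ∈ W₃, p w → p (cs.simple i.succ * w)) {w : W} (hw : w ∈ W₃) : p w := by
  refine Subgroup.closure_induction_left (p := fun w _ => p w) h1 ?_ ?_ hw
  · rintro x (rfl | rfl | rfl) y hy h
    exacts [hm 0 y hy h, hm 1 y hy h, hm 2 y hy h]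
  · rintro x (rfl | rfl | rfl) y hy h
    all_goals rw [CoxeterSystem.inv_simple]
    exacts [hm 0 y hy h, hm 1 y hy h, hm 2 y hy h]

theorem PosCone.dot {b : Fin 3 → ℤ} (h : PosCone b) {w : W} (hw : w ∈ W₃) :
    PosCone (dot w b) := by
  refine W₃_induction (p := fun w => PosCone (Apollonian.dot w b)) (by simpa) ?_ hw
  intro i w _ hp
  rw [map_mul, Equiv.Perm.mul_apply, dot_simple]
  exact hp.dotRefl i

/-! ### The antidominant chamber as a fundamental domain. -/

/-- Every element of `W₃` is given by a word without repeated neighbours. -/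
theorem exists_chain_of_mem_W₃ {w : W} (hw : w ∈ W₃) :
    ∃ L : List (Fin 3), L.IsChain (· ≠ ·) ∧ (L.map fun i => cs.simple i.succ).prod = w := by
  refine W₃_induction (p := fun w => ∃ L : List (Fin 3), L.IsChain (· ≠ ·) ∧
    (L.map fun i => cs.simple i.succ).prod = w) ⟨[], by simp⟩ ?_ hw
  rintro i _ - ⟨L, hL, rfl⟩
  cases L with
  | nil => exact ⟨[i], by simp⟩
  | cons j L =>
    by_cases h : i = j
    · subst h
      exact ⟨L, hL.of_cons, by simp [-CoxeterMatrix.toCoxeterSystem_simple, ← mul_assoc]⟩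
    · exact ⟨i :: j :: L, by simp [h, hL], by simp⟩

/-- The vectors `b` with `(b, α_i) ≤ 0` for the roots `α₂, α₃, α₄`. -/
def IsAntidominant (b : Fin 3 → ℤ) : Prop := ∀ i, pairing b i ≤ 0

/-- A ping-pong argument. For `p_j = pairing - 1`, the reflection in `α_i` sends `p_i` to `-p_i` and
`p_j` to `p_j + 2 p_i`, so it preserves `p_i + p_j`. The invariant "`p_i > 0` and `p_i + p_j < 0`
for the leading letter `i`" therefore passes on to the next, different letter. -/
theorem pairing_dot_chain {b : Fin 3 → ℤ} (hb : IsAntidominant b) (L : List (Fin 3)) :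
    ∀ i, (i :: L).IsChain (· ≠ ·) →
      1 < pairing (dot ((i :: L).map fun i => cs.simple i.succ).prod b) i ∧ ∀ j, j ≠ i →
        pairing (dot ((i :: L).map fun i => cs.simple i.succ).prod b) i +
          pairing (dot ((i :: L).map fun i => cs.simple i.succ).prod b) j < 2 := by
  induction L with
  | nil =>
    intro i _
    simp only [List.map_cons, List.map_nil, List.prod_cons, List.prod_nil, mul_one, dot_simple]
    have hi := hb i
    refine ⟨by rw [pairing_dotRefl_self]; omega, fun j hj => ?_⟩
    have := hb j
    rw [pairing_dotRefl_self, pairing_dotRefl_of_ne hj]; omega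
  | cons k L ih =>
    intro i hi
    rw [List.isChain_cons_cons] at hi
    obtain ⟨h1, h2⟩ := ih k hi.2
    rw [List.map_cons, List.prod_cons, map_mul, Equiv.Perm.mul_apply, dot_simple]
    set c := dot ((k :: L).map fun i => cs.simple i.succ).prod b
    have h3 := h2 i hi.1
    refine ⟨by rw [pairing_dotRefl_self]; omega, fun j hj => ?_⟩
    rw [pairing_dotRefl_self, pairing_dotRefl_of_ne hj]
    by_cases hjk : j = k
    · subst hjk; omega
    · have := h2 j hjk; omega

theorem eq_one_of_dot_eq {a b : Fin 3 → ℤ} (ha : IsAntidominant a) (hb : IsAntidominant b) {w : W}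
    (hw : w ∈ W₃) (h : dot w a = b) : w = 1 := by
  obtain ⟨L, hL, rfl⟩ := exists_chain_of_mem_W₃ hw
  cases L with
  | nil => simp
  | cons i L =>
    have := (pairing_dot_chain ha L i hL).1
    rw [h] at this
    have := hb i
    omega

/-- Descent on the coordinate sum: a positive pairing is at least 2 by `pairing_ne_one`, so the
reflection lowers the sum strictly, and on the cone the sum stays nonnegative. -/
theorem exists_dot_eq {b : Fin 3 → ℤ} (hb : PosCone b) :
    ∃ w ∈ W₃, ∃ a, 0 ≤ a ∧ IsAntidominant a ∧ dot w a = b := by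
  obtain ⟨N, hN⟩ : ∃ N : ℕ, ∑ j, b j ≤ N := ⟨_, Int.self_le_toNat _⟩
  induction N using Nat.strong_induction_on generalizing b with
  | _ N ih =>
    by_cases h : IsAntidominant b
    · exact ⟨1, one_mem _, b, hb.1, h, by simp⟩
    · simp only [IsAntidominant, not_forall, not_le] at h
      obtain ⟨i, hi⟩ := h
      have h1 := pairing_ne_one b i
      have hc := hb.dotRefl i
      have hs := sum_dotRefl i b
      have hnn : 0 ≤ ∑ j, dotRefl i b j := Finset.sum_nonneg fun j _ => hc.1 j
      obtain ⟨w, hw, a, h0, ha, hwa⟩ := ih (∑ j, dotRefl i b j).toNat (by omega) hc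
        (Int.self_le_toNat _)
      refine ⟨cs.simple i.succ * w, mul_mem (simple_succ_mem i) hw, a, h0, ha, ?_⟩
      rw [map_mul, Equiv.Perm.mul_apply, dot_simple, hwa, dotRefl_dotRefl]

/-- `(ρ+a, ρ+a) = ∑ a_i (a, α_i) - 2 ∑ a_i - 3/2`, and no term is positive. -/
theorem IsAntidominant.posCone {a : Fin 3 → ℤ} (h0 : 0 ≤ a) (ha : IsAntidominant a) :
    PosCone a := by
  refine ⟨h0, ?_⟩
  have h00 : 0 ≤ a 0 := h0 0
  have h01 : 0 ≤ a 1 := h0 1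
  have h02 : 0 ≤ a 2 := h0 2
  have h1 := ha 0
  have h2 := ha 1
  have h3 := ha 2
  simp only [pairing, Fin.sum_univ_three, disc] at *
  nlinarith [mul_nonneg h00 (sub_nonneg.2 h1), mul_nonneg h01 (sub_nonneg.2 h2),
    mul_nonneg h02 (sub_nonneg.2 h3)]

theorem form_rootVec (a : Fin 3 → ℕ) (i : Fin 3) :
    form (rootVec a) (α i.succ) = pairing (fun j => (a j : ℤ)) i := by
  fin_cases i <;>
    simp [form, rootVec, α, cartan, pairing, Fin.sum_univ_four, Fin.sum_univ_three,
      Pi.single_apply] <;> ring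

/-- The element `a` of the lattice underlying an antidominant one. -/
def Antidominant.coeffs (a : Antidominant) : Fin 3 → ℤ := fun j => (a.1 j : ℤ)

theorem Antidominant.isAntidominant (a : Antidominant) : IsAntidominant a.coeffs := fun i =>
  (form_rootVec a.1 i).symm.trans_le (a.2 i)

theorem Antidominant.posCone (a : Antidominant) : PosCone a.coeffs :=
  a.isAntidominant.posCone fun _ => Int.natCast_nonneg _

/-- The antidominant chamber is a fundamental domain for `W₃` on the positive cone. -/
def chamberEquiv : Antidominant × W₃ ≃ {b // PosCone b} :=
  Equiv.ofBijective (fun p => ⟨dot p.2 p.1.coeffs, p.1.posCone.dot p.2.2⟩) (by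
    constructor
    · rintro ⟨a, w, hw⟩ ⟨a', w', hw'⟩ h
      simp only [Subtype.mk.injEq] at h
      have h1 : dot (w'⁻¹ * w) a.coeffs = a'.coeffs := by
        rw [map_mul, Equiv.Perm.mul_apply, h, ← Equiv.Perm.mul_apply, ← map_mul]; simp
      have h2 := eq_one_of_dot_eq a.isAntidominant a'.isAntidominant
        (mul_mem (inv_mem hw') hw) h1
      obtain rfl : w' = w := by rwa [inv_mul_eq_one] at h2
      rw [h2] at h1
      have : a = a' := Subtype.ext (funext fun j => by
        have := congrFun h1 j
        simpa [Antidominant.coeffs] using this)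
      rw [this]
    · rintro ⟨b, hb⟩
      obtain ⟨w, hw, a, h0, ha, rfl⟩ := exists_dot_eq hb
      have ea : (fun j => ((a j).toNat : ℤ)) = a := funext fun j => Int.toNat_of_nonneg (h0 j)
      refine ⟨⟨⟨fun j => (a j).toNat, fun i => ?_⟩, w, hw⟩, ?_⟩
      · rw [form_rootVec, ea]; exact ha i
      · exact Subtype.ext (congrArg (dot w) ea))

@[simp]
theorem chamberEquiv_apply (p : Antidominant × W₃) :
    (chamberEquiv p : Fin 3 → ℤ) = dot p.2 p.1.coeffs := rfl

/-! ### The action of `W₃` on shifted lattice vectors -/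

/-- The complex vector `b 0 α₂ + b 1 α₃ + b 2 α₄`. -/
def latticeVec (b : Fin 3 → ℤ) : Fin 4 → ℂ := toC ![0, b 0, b 1, b 2]

/-- The hypotheses amount to `(c, α_i) = -1` for the three roots, so `c` may replace `ρ` in the
definition of the dot action. -/
theorem σ_add_latticeVec {c : Fin 4 → ℂ} (h1 : c 1 = c 2) (h2 : c 2 = c 3)
    (h3 : 2 * c 0 + 2 * c 1 = 1) (i : Fin 3) (b : Fin 3 → ℤ) :
    σ i.succ (c + latticeVec b) = c + latticeVec (dotRefl i b) := by
  have e1 : c 3 = c 1 := by rw [h1, h2]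
  have e0 : c 0 = 1 / 2 - c 1 := by linear_combination h3 / 2
  ext j
  fin_cases i <;> fin_cases j <;>
    simp [σ, form, α, cartan, Fin.sum_univ_four, Pi.single_apply, latticeVec, toC, dotRefl, pairing,
      Fin.sum_univ_three, ← h1, e1, e0] <;> ring

theorem act_add_latticeVec {c : Fin 4 → ℂ} (h1 : c 1 = c 2) (h2 : c 2 = c 3)
    (h3 : 2 * c 0 + 2 * c 1 = 1) (b : Fin 3 → ℤ) {w : W} (hw : w ∈ W₃) :
    act w (c + latticeVec b) = c + latticeVec (dot w b) := by
  refine W₃_induction (p := fun w => act w (c + latticeVec b) = c + latticeVec (dot w b))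
    (by simp) ?_ hw
  intro i w _ hp
  rw [map_mul, map_mul, Equiv.Perm.mul_apply, dot_simple, Module.End.mul_apply, hp, act,
    CoxeterSystem.lift_apply_simple, σ_add_latticeVec h1 h2 h3]

theorem form_add_left (x y s : Fin 4 → ℂ) : form (x + y) s = form x s + form y s := by
  simp [form, add_mul, Finset.sum_add_distrib]

theorem form_latticeVec (b : Fin 3 → ℤ) (s : Fin 4 → ℂ) :
    form (latticeVec b) s = ∑ i, (b i : ℂ) * form (α i.succ) s := by
  simp [form, latticeVec, toC, α, cartan, Fin.sum_univ_four, Fin.sum_univ_three, Pi.single_apply]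
  ring

/-- The exponential `e^{-(b, s)}`. -/
def latticeExp (s : Fin 4 → ℂ) (b : Fin 3 → ℤ) : ℂ := Complex.exp (-form (latticeVec b) s)

theorem latticeExp_zero (s : Fin 4 → ℂ) : latticeExp s 0 = 1 := by
  simp [latticeExp, form_latticeVec]

theorem latticeExp_add (s : Fin 4 → ℂ) (a b : Fin 3 → ℤ) :
    latticeExp s (a + b) = latticeExp s a * latticeExp s b := by
  simp only [latticeExp, ← Complex.exp_add, form_latticeVec]
  congr 1
  simp [Fin.sum_univ_three]; ring

theorem norm_latticeExp (s : Fin 4 → ℂ) (b : Fin 3 → ℤ) :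
    ‖latticeExp s b‖ = Real.exp (-∑ i, (b i : ℝ) * (form (α i.succ) s).re) := by
  rw [latticeExp, Complex.norm_exp, form_latticeVec]
  simp [Fin.sum_univ_three]

theorem exp_mul_altTerm {c : Fin 4 → ℂ} (h1 : c 1 = c 2) (h2 : c 2 = c 3)
    (h3 : 2 * c 0 + 2 * c 1 = 1) (s : Fin 4 → ℂ) (a : Fin 3 → ℤ) {w : W} (hw : w ∈ W₃) :
    Complex.exp (form c s) * altTerm (c + latticeVec a) s w =
      ((signHom w : ℤ) : ℂ) * latticeExp s (dot w a) := by
  rw [altTerm, act_add_latticeVec h1 h2 h3 a hw, form_add_left, latticeExp, sgn_eq, mul_left_comm,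
    ← Complex.exp_add]
  congr 2; ring

/-! ### Antisymmetry of the Fourier coefficients -/

/-- For odd `l`, `g k l` is a function of `4k - l²` times the theta sign `(-1)^((l-1)/2)`, and this
sign is odd under `l ↦ 4u - l`. -/
theorem g_eq_neg {k l k' l' : ℤ} (h : 4 * k' - l' ^ 2 = 4 * k - l ^ 2) (hl : 4 ∣ l + l') :
    g k' l' = -g k l := by
  obtain ⟨u, hu⟩ := hl
  obtain rfl : l' = 4 * u - l := by linarith
  have e : Odd (4 * u - l) ↔ Odd l := by
    rw [← Int.not_even_iff_odd, ← Int.not_even_iff_odd, Int.even_iff, Int.even_iff]; omega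
  simp only [g, h, e]
  split_ifs with hc
  · obtain ⟨t, rfl⟩ := hc.1
    have e1 : (2 * t + 1 - 1) / 2 = t := by omega
    have e2 : (4 * u - (2 * t + 1) - 1) / 2 = 2 * (u - 1) + (-t + 1) := by omega
    rw [e1, e2, Int.negOnePow_add, Int.negOnePow_two_mul, Int.negOnePow_succ, Int.negOnePow_neg]
    simp
  · simp

theorem dvd_gcd_gcd_iff {d : ℕ} {n l m : ℤ} :
    d ∣ Nat.gcd (Int.gcd l m) n.natAbs ↔ (d : ℤ) ∣ l ∧ (d : ℤ) ∣ m ∧ (d : ℤ) ∣ n := by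
  rw [Nat.dvd_gcd_iff, ← Int.natCast_dvd, ← Int.natCast_dvd_natCast, Int.dvd_coe_gcd_iff, and_assoc]

/-- Equal sets of common divisors let the two divisor sums be compared term by term; `d ∣ t` keeps
`l/d + l'/d` divisible by 4, as `g_eq_neg` requires. -/
theorem deltaCoeff_eq_neg {n l m n' l' m' t : ℤ}
    (hdvd : ∀ d : ℤ, d ∣ l ∧ d ∣ m ∧ d ∣ n ↔ d ∣ l' ∧ d ∣ m' ∧ d ∣ n')
    (hdisc : 4 * (m' * n') - l' ^ 2 = 4 * (m * n) - l ^ 2) (ht : l + l' = 4 * t)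
    (hdt : ∀ d : ℤ, d ∣ l → d ∣ m → d ∣ n → d ∣ t) :
    deltaCoeff n' l' m' = -deltaCoeff n l m := by
  have hg : Nat.gcd (Int.gcd l' m') n'.natAbs = Nat.gcd (Int.gcd l m) n.natAbs := by
    refine Nat.dvd_antisymm ?_ ?_
    · rw [dvd_gcd_gcd_iff, hdvd, ← dvd_gcd_gcd_iff]
    · rw [dvd_gcd_gcd_iff, ← hdvd, ← dvd_gcd_gcd_iff]
  rw [deltaCoeff, deltaCoeff, hg, ← Finset.sum_neg_distrib]
  refine Finset.sum_congr rfl fun d hd => ?_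
  have hd0 : d ≠ 0 := (Nat.pos_of_mem_divisors hd).ne'
  have hd' := dvd_gcd_gcd_iff.1 (Nat.dvd_of_mem_divisors hd)
  obtain ⟨⟨l1, rfl⟩, ⟨m1, rfl⟩, ⟨n1, rfl⟩⟩ := hd'
  obtain ⟨⟨l1', rfl⟩, ⟨m1', rfl⟩, ⟨n1', rfl⟩⟩ := (hdvd d).1
    (dvd_gcd_gcd_iff.1 (Nat.dvd_of_mem_divisors hd))
  obtain ⟨t1, rfl⟩ := hdt d (dvd_mul_right _ _) (dvd_mul_right _ _) (dvd_mul_right _ _)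
  have hdz : (d : ℤ) ≠ 0 := by exact_mod_cast hd0
  have q1 : ∀ x y : ℤ, d * x * (d * y) / (d : ℤ) ^ 2 = x * y := fun x y => by
    rw [show d * x * (d * y) = (d : ℤ) ^ 2 * (x * y) by ring]
    exact Int.mul_ediv_cancel_left _ (pow_ne_zero _ hdz)
  rw [q1, q1, Int.mul_ediv_cancel_left _ hdz, Int.mul_ediv_cancel_left _ hdz, ← mul_neg]
  congr 1
  refine g_eq_neg ?_ ⟨t1, ?_⟩
  · refine mul_left_cancel₀ (pow_ne_zero 2 hdz) ?_
    linear_combination hdisc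
  · refine mul_left_cancel₀ hdz ?_
    linear_combination ht

/-- The coefficient of `Δ₅ / 64` at `e^{-(ρ + b, s)}`. -/
def fourierCoeff (b : Fin 3 → ℤ) : ℤ :=
  deltaCoeff (2 * b 0 + 1) (2 * (b 0 + b 1 - b 2) + 1) (2 * b 1 + 1)

/-- On the binary form `n x² + l x y + m y²` the reflections are the substitutions `y ↦ -2x - y`, `x
↦ -x - 2y` and `y ↦ -y` of determinant `-1`, which preserve discriminant and content. -/
theorem fourierCoeff_dotRefl (i : Fin 3) (b : Fin 3 → ℤ) :
    fourierCoeff (dotRefl i b) = -fourierCoeff b := by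
  unfold fourierCoeff
  have key1 : ∀ n l m : ℤ, deltaCoeff (n - 2 * l + 4 * m) (4 * m - l) m = -deltaCoeff n l m := by
    intro n l m
    refine deltaCoeff_eq_neg (t := m) (fun d => ⟨?_, ?_⟩) (by ring) (by ring) fun d _ h _ => h
    · rintro ⟨h1, h2, h3⟩
      exact ⟨(h2.mul_left 4).sub h1, h2, (h3.sub (h1.mul_left 2)).add (h2.mul_left 4)⟩
    · rintro ⟨h1, h2, h3⟩
      have h4 : d ∣ l := by simpa using (h2.mul_left 4).sub h1
      refine ⟨h4, h2, ?_⟩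
      simpa using (h3.sub (h2.mul_left 4)).add (h4.mul_left 2)
  have key2 : ∀ n l m : ℤ, deltaCoeff n (4 * n - l) (m - 2 * l + 4 * n) = -deltaCoeff n l m := by
    intro n l m
    refine deltaCoeff_eq_neg (t := n) (fun d => ⟨?_, ?_⟩) (by ring) (by ring) fun d _ _ h => h
    · rintro ⟨h1, h3, h2⟩
      exact ⟨(h2.mul_left 4).sub h1, (h3.sub (h1.mul_left 2)).add (h2.mul_left 4), h2⟩
    · rintro ⟨h1, h3, h2⟩
      have h4 : d ∣ l := by simpa using (h2.mul_left 4).sub h1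
      refine ⟨h4, ?_, h2⟩
      simpa using (h3.sub (h2.mul_left 4)).add (h4.mul_left 2)
  have key3 : ∀ n l m : ℤ, deltaCoeff n (-l) m = -deltaCoeff n l m := by
    intro n l m
    exact deltaCoeff_eq_neg (t := 0) (fun d => by simp) (by ring) (by ring) (by simp)
  fin_cases i
  · rw [← key1]; simp [dotRefl, pairing, Fin.sum_univ_three]; ring_nf
  · rw [← key2]; simp [dotRefl, pairing, Fin.sum_univ_three]; ring_nf
  · rw [← key3]; simp [dotRefl, pairing, Fin.sum_univ_three]; ring_nf

theorem fourierCoeff_dot (b : Fin 3 → ℤ) {w : W} (hw : w ∈ W₃) :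
    fourierCoeff (dot w b) = signHom w * fourierCoeff b := by
  refine W₃_induction (p := fun w => fourierCoeff (dot w b) = signHom w * fourierCoeff b)
    (by simp) ?_ hw
  intro i w _ hp
  rw [map_mul, map_mul, Equiv.Perm.mul_apply, dot_simple, fourierCoeff_dotRefl, hp, signHom_simple]
  simp

theorem fourierCoeff_zero : fourierCoeff 0 = 1 := by
  simp [fourierCoeff, deltaCoeff, g, eta9Coeff]

/-- The indices of the Fourier expansion of `Δ₅` as lattice vectors in the positive cone. -/
def posConeEquiv : {b // PosCone b} ≃ DeltaIndex where
  toFun b := ⟨(2 * b.1 0 + 1, 2 * (b.1 0 + b.1 1 - b.1 2) + 1, 2 * b.1 1 + 1), by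
    obtain ⟨b, h0, hd⟩ := b
    have h00 : 0 ≤ b 0 := h0 0
    have h01 : 0 ≤ b 1 := h0 1
    refine ⟨⟨_, rfl⟩, ⟨_, rfl⟩, ⟨_, rfl⟩, by simp only; omega, by simp only; omega, ?_⟩
    simp only [disc, Fin.sum_univ_three] at hd ⊢
    nlinarith⟩
  invFun p := ⟨![(p.1.1 - 1) / 2, (p.1.2.2 - 1) / 2,
      (p.1.1 - 1) / 2 + (p.1.2.2 - 1) / 2 - (p.1.2.1 - 1) / 2], by
    obtain ⟨⟨n, l, m⟩, hn', hl', hm', hm, hn, hd⟩ := p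
    simp only at hn' hl' hm' hm hn hd ⊢
    obtain ⟨n, rfl⟩ := hn'
    obtain ⟨l, rfl⟩ := hl'
    obtain ⟨m, rfl⟩ := hm'
    have e : ∀ x : ℤ, (2 * x + 1 - 1) / 2 = x := fun x => by omega
    simp only [e]
    -- Nonnegativity of the third coordinate: `(2l+1)² < 4(2n+1)(2m+1) ≤ (2n+2m+2)²`.
    have hl : l ≤ n + m := by
      by_contra! h
      have : (n + m + 1) * (n + m + 1) ≤ l * l := mul_self_le_mul_self (by omega) (by omega)
      nlinarith [sq_nonneg (n - m)]
    refine ⟨fun j => ?_, ?_⟩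
    · fin_cases j <;> simp <;> omega
    · simp [disc, Fin.sum_univ_three]; nlinarith⟩
  left_inv b := by
    refine Subtype.ext (funext fun j => ?_)
    fin_cases j <;> simp
  right_inv p := by
    obtain ⟨⟨n, l, m⟩, hn', hl', hm', hm, hn, hd⟩ := p
    simp only at hn' hl' hm'
    obtain ⟨n, rfl⟩ := hn'
    obtain ⟨l, rfl⟩ := hl'
    obtain ⟨m, rfl⟩ := hm'
    refine Subtype.ext ?_
    simp

theorem deltaTerm_posConeEquiv {z₀ z₁ z₂ z₃ : ℂ} {s : Fin 4 → ℂ} {Z : Matrix (Fin 2) (Fin 2) ℂ}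
    (hs : s = sVec z₀ z₁ z₂ z₃) (hZ : Z = (1 / (Real.pi * Complex.I) : ℂ) • !![z₁, z₂; z₂, z₃])
    (b : {b // PosCone b}) :
    Complex.exp (form ρ s) * deltaTerm Z (posConeEquiv b) =
      (fourierCoeff b : ℂ) * latticeExp s b := by
  have hpi : (Real.pi : ℂ) ≠ 0 := by simp [Real.pi_ne_zero]
  have e1 : (posConeEquiv b).1.1 = 2 * b.1 0 + 1 := rfl
  have e2 : (posConeEquiv b).1.2.1 = 2 * (b.1 0 + b.1 1 - b.1 2) + 1 := rfl
  have e3 : (posConeEquiv b).1.2.2 = 2 * b.1 1 + 1 := rfl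
  rw [deltaTerm, mul_left_comm, ← Complex.exp_add, latticeExp]
  congr 2
  subst hs hZ
  simp [e1, e2, e3, form, ρ, sVec, ω, latticeVec, toC, α, cartan, Fin.sum_univ_four,
    Pi.single_apply]
  field_simp
  ring_nf
  simp only [Complex.I_sq]
  ring

/-! ### Growth of the Fourier coefficients and absolute convergence -/

theorem exists_abs_g_le :
    ∃ C : ℝ, 0 < C ∧ ∀ k l : ℤ, 0 ≤ k → |(g k l : ℝ)| ≤ C * (k + 1) ^ 3 := by
  obtain ⟨C, hC0, hC⟩ := exists_abs_eta9Coeff_le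
  refine ⟨C, hC0, fun k l hk => ?_⟩
  have hk' : (0 : ℝ) ≤ k := by exact_mod_cast hk
  rw [g]
  split_ifs with h
  · set N := ((4 * k - l ^ 2 - 3) / 8).toNat with hN
    have h1 : (N : ℤ) ≤ k := by
      rw [hN, Int.toNat_of_nonneg (by omega)]
      have := sq_nonneg l
      omega
    have h1' : (N : ℝ) ≤ k := by exact_mod_cast h1
    have h2 : |((((l - 1) / 2).negOnePow : ℤ) : ℝ)| = 1 := by
      rcases Int.units_eq_one_or ((l - 1) / 2).negOnePow with h | h <;> simp [h]
    rw [Int.cast_mul, abs_mul, h2, one_mul]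
    refine (hC N).trans ?_
    gcongr
  · simp; positivity

/-- The exponent is `11 = 1 + 4 + 6`: at most `T` divisors, `d⁴ ≤ T⁴`, and a cubic bound on `g` at
an argument of size at most `T²`. -/
theorem exists_abs_deltaCoeff_le :
    ∃ C : ℝ, 0 < C ∧ ∀ (n l m : ℤ) (T : ℝ), 0 < n → 0 < m → n ≤ T → m ≤ T →
      |(deltaCoeff n l m : ℝ)| ≤ C * (T + 1) ^ 11 := by
  obtain ⟨C, hC0, hC⟩ := exists_abs_g_le
  refine ⟨C, hC0, fun n l m T hn hm hnT hmT => ?_⟩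
  have hn' : (0 : ℝ) < n := by exact_mod_cast hn
  have hm' : (0 : ℝ) < m := by exact_mod_cast hm
  have hT : 0 < T := hn'.trans_le hnT
  have hterm : ∀ d ∈ (Nat.gcd (Int.gcd l m) n.natAbs).divisors,
      |(((d : ℤ) ^ 4 * g (m * n / (d : ℤ) ^ 2) (l / d) : ℤ) : ℝ)| ≤
        T ^ 4 * (C * (T ^ 2 + 1) ^ 3) := by
    intro d hd
    have hdn : (d : ℤ) ∣ n := (dvd_gcd_gcd_iff.1 (Nat.dvd_of_mem_divisors hd)).2.2
    have hdT : (d : ℝ) ≤ T :=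
      le_trans (by exact_mod_cast Int.le_of_dvd hn hdn) hnT
    have hk0 : 0 ≤ m * n / (d : ℤ) ^ 2 := Int.ediv_nonneg (by positivity) (by positivity)
    have hk : m * n / (d : ℤ) ^ 2 ≤ m * n := Int.ediv_le_self _ (by positivity)
    have hk' : ((m * n / (d : ℤ) ^ 2 : ℤ) : ℝ) ≤ T ^ 2 := by
      calc ((m * n / (d : ℤ) ^ 2 : ℤ) : ℝ) ≤ ((m * n : ℤ) : ℝ) := by exact_mod_cast hk
        _ = m * n := by push_cast; ring
        _ ≤ T * T := by gcongr
        _ = T ^ 2 := by ring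
    have hk0' : (0 : ℝ) ≤ ((m * n / (d : ℤ) ^ 2 : ℤ) : ℝ) := by exact_mod_cast hk0
    rw [Int.cast_mul, abs_mul]
    have e : |(((d : ℤ) ^ 4 : ℤ) : ℝ)| = (d : ℝ) ^ 4 := by simp
    rw [e]
    gcongr
    refine (hC _ _ hk0).trans ?_
    gcongr
  have hcard : ((Nat.gcd (Int.gcd l m) n.natAbs).divisors.card : ℝ) ≤ T := by
    refine le_trans ?_ hnT
    have h1 := Nat.card_divisors_le_self (Nat.gcd (Int.gcd l m) n.natAbs)
    have h2 : Nat.gcd (Int.gcd l m) n.natAbs ≤ n.natAbs :=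
      Nat.le_of_dvd (by omega) (Nat.gcd_dvd_right _ _)
    have h3 : ((Nat.gcd (Int.gcd l m) n.natAbs).divisors.card : ℤ) ≤ n := by omega
    exact_mod_cast h3
  rw [deltaCoeff, Int.cast_sum]
  calc |∑ d ∈ (Nat.gcd (Int.gcd l m) n.natAbs).divisors,
          (((d : ℤ) ^ 4 * g (m * n / (d : ℤ) ^ 2) (l / d) : ℤ) : ℝ)| ≤ _ :=
        Finset.abs_sum_le_sum_abs _ _
    _ ≤ (Nat.gcd (Int.gcd l m) n.natAbs).divisors.card • (T ^ 4 * (C * (T ^ 2 + 1) ^ 3)) :=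
        Finset.sum_le_card_nsmul _ _ _ hterm
    _ ≤ T * (T ^ 4 * (C * (T ^ 2 + 1) ^ 3)) := by
        rw [nsmul_eq_mul]; gcongr
    _ ≤ (T + 1) * ((T + 1) ^ 4 * (C * ((T + 1) ^ 2) ^ 3)) := by
        gcongr
        · linarith
        · linarith
        · nlinarith
    _ = C * (T + 1) ^ 11 := by ring

theorem exists_abs_fourierCoeff_le :
    ∃ C : ℝ, 0 < C ∧ ∀ b : Fin 3 → ℤ, PosCone b →
      |(fourierCoeff b : ℝ)| ≤ C * (((∑ i, b i : ℤ) : ℝ) + 1) ^ 11 := by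
  obtain ⟨C, hC0, hC⟩ := exists_abs_deltaCoeff_le
  refine ⟨C * 2 ^ 11, by positivity, fun b hb => ?_⟩
  have h00 : 0 ≤ b 0 := hb.1 0
  have h01 : 0 ≤ b 1 := hb.1 1
  have h02 : 0 ≤ b 2 := hb.1 2
  refine (hC _ _ _ (((2 * ∑ i, b i + 1 : ℤ)) : ℝ) (by omega) (by omega) ?_ ?_).trans (le_of_eq ?_)
  · rw [Int.cast_le, Fin.sum_univ_three]; omega
  · rw [Int.cast_le, Fin.sum_univ_three]; omega
  · push_cast; ring

theorem sum_pow_le {r : ℝ} (h0 : 0 ≤ r) (h1 : r < 1) (F : Finset (Fin 3 → ℕ)) :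
    ∑ b ∈ F, r ^ (∑ i, b i) ≤ (1 - r)⁻¹ ^ 3 := by
  set N := F.sup fun b => ∑ i, b i with hN
  have hF : F ⊆ Fintype.piFinset fun _ : Fin 3 => Finset.range (N + 1) := by
    intro b hb
    rw [Fintype.mem_piFinset]
    intro i
    rw [Finset.mem_range, Nat.lt_succ_iff]
    exact (Finset.single_le_sum (fun j _ => Nat.zero_le (b j)) (Finset.mem_univ i)).trans
      (Finset.le_sup (f := fun b : Fin 3 → ℕ => ∑ i, b i) hb)
  calc ∑ b ∈ F, r ^ (∑ i, b i)
      ≤ ∑ b ∈ Fintype.piFinset fun _ : Fin 3 => Finset.range (N + 1), r ^ (∑ i, b i) :=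
        Finset.sum_le_sum_of_subset_of_nonneg hF fun _ _ _ => by positivity
    _ = ∏ _i : Fin 3, ∑ k ∈ Finset.range (N + 1), r ^ k := by
        rw [Finset.prod_univ_sum]
        exact Finset.sum_congr rfl fun b _ => (Finset.prod_pow_eq_pow_sum _ _ _).symm
    _ ≤ ∏ _i : Fin 3, (1 - r)⁻¹ := by
        refine Finset.prod_le_prod (fun _ _ => by positivity) fun _ _ => ?_
        rw [← tsum_geometric_of_lt_one h0 h1]
        exact (summable_geometric_of_lt_one h0 h1).sum_le_tsum _ fun _ _ => by positivity
    _ = _ := by simp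

theorem summable_pow_sum {r : ℝ} (h0 : 0 ≤ r) (h1 : r < 1) :
    Summable fun b : Fin 3 → ℕ => r ^ (∑ i, b i) :=
  summable_of_sum_le (fun _ => by positivity) (sum_pow_le h0 h1)

theorem summable_exp_neg_posCone {ε : ℝ} (hε : 0 < ε) :
    Summable fun b : {b // PosCone b} => Real.exp (-(ε * ((∑ i, b.1 i : ℤ) : ℝ))) := by
  have hr : Real.exp (-ε) < 1 := by simpa using hε
  have hinj : Function.Injective fun (b : {b // PosCone b}) (i : Fin 3) => (b.1 i).toNat := by
    intro a b h
    refine Subtype.ext (funext fun i => ?_)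
    have h1 := congrFun h i
    have h2 : 0 ≤ a.1 i := a.2.1 i
    have h3 : 0 ≤ b.1 i := b.2.1 i
    simp only at h1
    omega
  refine ((summable_pow_sum (Real.exp_pos _).le hr).comp_injective hinj).congr fun b => ?_
  rw [Function.comp_apply, ← Real.exp_nat_mul]
  congr 1
  have : ((∑ i, (b.1 i).toNat : ℕ) : ℤ) = ∑ i, b.1 i := by
    push_cast
    exact Finset.sum_congr rfl fun i _ => Int.toNat_of_nonneg (b.2.1 i)
  rw [← this]
  push_cast
  ring

/-- A positive definite binary form is bounded below by the trace on positive semidefinite ones. -/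
theorem exists_mul_add_le_of_posDef {P Q R : ℝ} (hP : 0 < P) (hD : 0 < P * Q - R ^ 2) :
    ∃ c : ℝ, 0 < c ∧ ∀ n m l : ℝ, 0 ≤ n → 0 ≤ m → l ^ 2 ≤ 4 * (n * m) →
      c * (n + m) ≤ n * P + m * Q - l * R := by
  have hQ : 0 < Q := by
    by_contra! h
    nlinarith [sq_nonneg R, mul_nonneg hP.le (neg_nonneg.2 h)]
  have hPQ : 0 < P + Q := by positivity
  -- Determinant over trace lies below the smallest eigenvalue, and it makes `(P - c)(Q - c) = R² +
  -- c²`. The claim is then the inequality of arithmetic and geometric means.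
  obtain ⟨c, hc⟩ : ∃ c, c = (P * Q - R ^ 2) / (P + Q) := ⟨_, rfl⟩
  have hc0 : 0 < c := by rw [hc]; positivity
  have hcD : c * (P + Q) = P * Q - R ^ 2 := by rw [hc]; field_simp
  have hPQ' : (P - c) * (Q - c) = R ^ 2 + c ^ 2 := by linear_combination -hcD
  have hP0 : 0 ≤ P - c := by
    rw [hc, sub_nonneg, div_le_iff₀ hPQ]; nlinarith [sq_nonneg R, sq_nonneg P]
  have hQ0 : 0 ≤ Q - c := by
    rw [hc, sub_nonneg, div_le_iff₀ hPQ]; nlinarith [sq_nonneg R, sq_nonneg Q]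
  refine ⟨c, hc0, fun n m l hn hm hl => ?_⟩
  have hsq : (l * R) ^ 2 ≤ (n * (P - c) + m * (Q - c)) ^ 2 := by
    calc (l * R) ^ 2 = l ^ 2 * R ^ 2 := by ring
      _ ≤ (4 * (n * m)) * (R ^ 2 + c ^ 2) := by
        gcongr
        exact le_add_of_nonneg_right (sq_nonneg c)
      _ = (n * (P - c) + m * (Q - c)) ^ 2 - (n * (P - c) - m * (Q - c)) ^ 2 := by
        rw [← hPQ']; ring
      _ ≤ _ := sub_le_self _ (sq_nonneg _)
  have := (abs_le.1 (abs_le_of_sq_le_sq hsq (by positivity))).2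
  linarith

/-- Lower bound on the positive cone for linear forms `t` in the dual cone. -/
theorem exists_mul_sum_le {t : Fin 3 → ℝ} (h1 : 0 < t 0 + t 2)
    (h2 : 0 < t 0 * t 1 + t 0 * t 2 + t 1 * t 2) :
    ∃ ε : ℝ, 0 < ε ∧ ∀ b : Fin 3 → ℤ, PosCone b →
      ε * ((∑ i, b i : ℤ) : ℝ) ≤ ∑ i, (b i : ℝ) * t i + (∑ i, t i) / 2 := by
  -- In the Fourier indices `n, l, m` of `b`, twice the right-hand side is `n (t 0 + t 2) + m (t 1 +
  -- t 2) - l (t 2)`.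
  obtain ⟨c, hc0, hc⟩ := exists_mul_add_le_of_posDef (Q := t 1 + t 2) (R := t 2) h1
    (by linarith)
  -- Since `|l| ≤ n + m`, the coordinate sum of `b` is at most `3/2 (n + m)`; the form just
  -- described gives `c/2 (n + m)`.
  refine ⟨c / 3, by positivity, fun b hb => ?_⟩
  obtain ⟨hb0, hbd⟩ := hb
  have h00 : (0 : ℝ) ≤ b 0 := by exact_mod_cast hb0 0
  have h01 : (0 : ℝ) ≤ b 1 := by exact_mod_cast hb0 1
  have hd : (0 : ℝ) < (disc b : ℝ) := by exact_mod_cast hbd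
  simp only [disc, Fin.sum_univ_three] at hd ⊢
  push_cast at hd ⊢
  have hd' : (2 * b 0 + 2 * b 1 - 2 * b 2 + 1 : ℝ) ^ 2 ≤
      4 * ((2 * b 0 + 1) * (2 * b 1 + 1)) := by linarith
  have h3 := hc (2 * b 0 + 1) (2 * b 1 + 1) (2 * b 0 + 2 * b 1 - 2 * b 2 + 1) (by positivity)
    (by positivity) hd'
  have hln : |(2 * b 0 + 2 * b 1 - 2 * b 2 + 1 : ℝ)| ≤ 2 * b 0 + 2 * b 1 + 2 :=
    abs_le_of_sq_le_sq (by nlinarith [sq_nonneg (b 0 - b 1 : ℝ)]) (by positivity)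
  have h4 := (abs_le.1 hln).1
  have h5 : c / 3 * (b 0 + b 1 + b 2 : ℝ) ≤ c / 3 * (3 / 2 * (2 * b 0 + 2 * b 1 + 2)) := by
    gcongr
    linarith
  linarith

/-- Absolute convergence of lattice sums over the positive cone with polynomially bounded
coefficients. -/
theorem summable_mul_latticeExp {t : Fin 3 → ℝ} {s : Fin 4 → ℂ}
    (ht : ∀ i, t i = (form (α i.succ) s).re) (h1 : 0 < t 0 + t 2)
    (h2 : 0 < t 0 * t 1 + t 0 * t 2 + t 1 * t 2) {f : {b // PosCone b} → ℤ} {C : ℝ} {k : ℕ}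
    (hf : ∀ b, |(f b : ℝ)| ≤ C * (((∑ i, b.1 i : ℤ) : ℝ) + 1) ^ k) :
    Summable fun b : {b // PosCone b} => (f b : ℂ) * latticeExp s b := by
  obtain ⟨ε, hε, hb⟩ := exists_mul_sum_le h1 h2
  have hC : 0 ≤ C := by
    have h0 : PosCone 0 := ⟨le_rfl, by simp [disc]⟩
    simpa using (abs_nonneg _).trans (hf ⟨0, h0⟩)
  obtain ⟨M, hM⟩ : ∃ M : ℝ, ∀ x : ℝ, 0 ≤ x → (x + 1) ^ k ≤ M * Real.exp (ε / 2 * x) := by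
    refine ⟨k.factorial * (2 / ε) ^ k * Real.exp (ε / 2), fun x hx => ?_⟩
    have h := Real.pow_div_factorial_le_exp (ε / 2 * (x + 1)) (by positivity) k
    rw [div_le_iff₀ (by positivity), mul_pow] at h
    calc (x + 1) ^ k = (2 / ε) ^ k * ((ε / 2) ^ k * (x + 1) ^ k) := by
          rw [← mul_assoc, ← mul_pow]; field_simp; simp
      _ ≤ (2 / ε) ^ k * (Real.exp (ε / 2 * (x + 1)) * k.factorial) := by gcongr
      _ = _ := by rw [mul_add, mul_one, Real.exp_add]; ring
  refine Summable.of_norm_bounded (((summable_exp_neg_posCone (half_pos hε)).mul_left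
    (C * M * Real.exp ((∑ i, t i) / 2)))) fun b => ?_
  have hs0 : (0 : ℝ) ≤ ((∑ i, b.1 i : ℤ) : ℝ) := by
    exact_mod_cast Finset.sum_nonneg fun i _ => b.2.1 i
  have hb' := hb b.1 b.2
  rw [norm_mul, norm_latticeExp]
  have e1 : ‖(f b : ℂ)‖ = |(f b : ℝ)| := by simp
  rw [e1]
  simp only [← ht]
  set x : ℝ := ((∑ i, b.1 i : ℤ) : ℝ)
  calc |(f b : ℝ)| * Real.exp (-∑ i, (b.1 i : ℝ) * t i)
      ≤ (C * (x + 1) ^ k) * Real.exp (-(ε * x) + (∑ i, t i) / 2) := by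
        gcongr
        · exact hf b
        · linarith
    _ ≤ (C * (M * Real.exp (ε / 2 * x))) * Real.exp (-(ε * x) + (∑ i, t i) / 2) := by
        gcongr
        exact hM x hs0
    _ = (C * M * Real.exp ((∑ i, t i) / 2)) *
          (Real.exp (ε / 2 * x) * Real.exp (-(ε * x))) := by rw [Real.exp_add]; ring
    _ = _ := by rw [← Real.exp_add]; congr 2; ring

/-! ### The Siegel half-space in terms of `Re (α_i, s)`. -/

theorem posDef_fin_two_iff {a b d : ℝ} :
    !![a, b; b, d].PosDef ↔ 0 < a ∧ 0 < a * d - b ^ 2 := by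
  constructor
  · intro h
    refine ⟨h.diag_pos (i := 0), ?_⟩
    have := h.det_pos
    rw [Matrix.det_fin_two_of] at this
    linarith
  · rintro ⟨ha, hd⟩
    refine Matrix.PosDef.of_dotProduct_mulVec_pos ?_ fun x hx => ?_
    · ext i j
      fin_cases i <;> fin_cases j <;> simp
    · have e : star x ⬝ᵥ (!![a, b; b, d] *ᵥ x) = a * x 0 ^ 2 + 2 * b * x 0 * x 1 + d * x 1 ^ 2 := by
        simp [Matrix.mulVec, dotProduct, Fin.sum_univ_two]
        ring
      rw [e]
      refine pos_of_mul_pos_right ?_ ha.le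
      have e2 : a * (a * x 0 ^ 2 + 2 * b * x 0 * x 1 + d * x 1 ^ 2) =
          (a * x 0 + b * x 1) ^ 2 + (a * d - b ^ 2) * x 1 ^ 2 := by ring
      rw [e2]
      by_cases h1 : x 1 = 0
      · have h0 : x 0 ≠ 0 := fun h0 => hx (by ext i; fin_cases i <;> simp [h0, h1])
        rw [h1]
        have : 0 < (a * x 0) ^ 2 := by positivity
        simpa using this
      · positivity

/-- The half-space condition on `Z`, in terms of `Re (α_i, s)`. -/
theorem mem_siegelH_iff {z₀ z₁ z₂ z₃ : ℂ} {s : Fin 4 → ℂ} {Z : Matrix (Fin 2) (Fin 2) ℂ}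
    (hs : s = sVec z₀ z₁ z₂ z₃) (hZ : Z = (1 / (Real.pi * Complex.I) : ℂ) • !![z₁, z₂; z₂, z₃])
    {t : Fin 3 → ℝ} (ht : ∀ i, t i = (form (α i.succ) s).re) :
    Z ∈ siegelH ↔ 0 < t 0 + t 2 ∧ 0 < t 0 * t 1 + t 0 * t 2 + t 1 * t 2 := by
  have hpi := Real.pi_pos
  have him : ∀ z : ℂ, (1 / (Real.pi * Complex.I) * z : ℂ).im = -z.re / Real.pi := by
    intro z
    have : (1 / (Real.pi * Complex.I) * z : ℂ) = ((-1 / Real.pi : ℝ) : ℂ) * (Complex.I * z) := by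
      push_cast
      have : (Real.pi : ℂ) ≠ 0 := by exact_mod_cast hpi.ne'
      field_simp
      simp
    rw [this, Complex.im_ofReal_mul]
    simp
    ring
  -- `z₀` drops out because `ω 0` is orthogonal to the three roots. The two conditions are the
  -- leading minors of `-Re` of the matrix of the `z_i`, up to positive factors.
  have e0 : t 0 = -2 * z₁.re - 2 * z₂.re := by
    rw [ht, hs]
    simp [form, sVec, ω, α, cartan, Fin.sum_univ_four, Pi.single_apply]
    ring
  have e1 : t 1 = -2 * z₂.re - 2 * z₃.re := by
    rw [ht, hs]
    simp [form, sVec, ω, α, cartan, Fin.sum_univ_four, Pi.single_apply]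
    ring
  have e2 : t 2 = 2 * z₂.re := by
    rw [ht, hs]
    simp [form, sVec, ω, α, cartan, Fin.sum_univ_four, Pi.single_apply]
    ring
  have hM : Z.map Complex.im = !![-z₁.re / Real.pi, -z₂.re / Real.pi;
      -z₂.re / Real.pi, -z₃.re / Real.pi] := by
    rw [hZ]
    ext i j
    fin_cases i <;> fin_cases j <;> simpa using him _
  have hsymm : Z.IsSymm := by
    rw [hZ]
    ext i j
    fin_cases i <;> fin_cases j <;> simp
  rw [siegelH, Set.mem_ofPred_eq, and_iff_right hsymm, hM, posDef_fin_two_iff, e0, e1, e2]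
  refine and_congr ?_ ?_
  · rw [div_pos_iff_of_pos_right hpi]
    constructor <;> intro h <;> linarith
  · have : -z₁.re / Real.pi * (-z₃.re / Real.pi) - (-z₂.re / Real.pi) ^ 2 =
        (z₁.re * z₃.re - z₂.re ^ 2) / Real.pi ^ 2 := by field_simp
    rw [this, div_pos_iff_of_pos_right (by positivity)]
    constructor <;> intro h <;> linarith

/-! ### Formal quotients of antisymmetric series -/

/-- The linear reflection `σ_i`. -/
def latticeRefl (i : Fin 3) (b : Fin 3 → ℤ) : Fin 3 → ℤ := b - Pi.single i (pairing b i)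

theorem dotRefl_eq (i : Fin 3) (b : Fin 3 → ℤ) :
    dotRefl i b = latticeRefl i b + Pi.single i 1 := by
  ext j
  by_cases h : j = i
  · subst h; simp [dotRefl, latticeRefl]; ring
  · simp [dotRefl, latticeRefl, h]

theorem pairing_sub (a b : Fin 3 → ℤ) (i : Fin 3) :
    pairing (a - b) i = pairing a i - pairing b i := by
  simp [pairing]; ring

theorem pairing_add (a b : Fin 3 → ℤ) (i : Fin 3) :
    pairing (a + b) i = pairing a i + pairing b i := by
  simp [pairing, Finset.sum_add_distrib]; ring

theorem pairing_single_self (i : Fin 3) (t : ℤ) : pairing (Pi.single i t) i = 2 * t := by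
  simp [pairing]; ring

theorem latticeRefl_sub (i : Fin 3) (a b : Fin 3 → ℤ) :
    latticeRefl i (a - b) = dotRefl i a - dotRefl i b := by
  rw [dotRefl_eq, dotRefl_eq, latticeRefl, latticeRefl, latticeRefl, pairing_sub, Pi.single_sub]
  abel

/-- The sum of the coordinates of `b` away from `i`. -/
def offHeight (i : Fin 3) (b : Fin 3 → ℤ) : ℤ := ∑ j ∈ Finset.univ.erase i, b j

theorem offHeight_congr {i : Fin 3} {a b : Fin 3 → ℤ} (h : ∀ j, j ≠ i → a j = b j) :
    offHeight i a = offHeight i b :=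
  Finset.sum_congr rfl fun j hj => h j (Finset.ne_of_mem_erase hj)

theorem offHeight_sub (i : Fin 3) (a b : Fin 3 → ℤ) :
    offHeight i (a - b) = offHeight i a - offHeight i b := by
  simp [offHeight]

theorem offHeight_nonneg {i : Fin 3} {a : Fin 3 → ℤ} (h : 0 ≤ a) : 0 ≤ offHeight i a :=
  Finset.sum_nonneg fun j _ => h j

theorem eq_single_of_offHeight_eq_zero {i : Fin 3} {a : Fin 3 → ℤ} (h : 0 ≤ a)
    (h0 : offHeight i a = 0) : a = Pi.single i (a i) := by
  ext j
  by_cases hj : j = i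
  · subst hj; simp
  · rw [Pi.single_eq_of_ne hj]
    exact (Finset.sum_eq_zero_iff_of_nonneg fun j _ => h j).1 h0 j (by simp [hj])

theorem latticeRefl_of_ne {i j : Fin 3} (h : j ≠ i) (b : Fin 3 → ℤ) : latticeRefl i b j = b j := by
  simp [latticeRefl, h]

theorem dotRefl_of_ne {i j : Fin 3} (h : j ≠ i) (b : Fin 3 → ℤ) : dotRefl i b j = b j := by
  simp [dotRefl, h]

theorem finite_support_conv {n q : (Fin 3 → ℤ) → ℤ} (hn : ∀ a, n a ≠ 0 → 0 ≤ a)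
    (hq : ∀ a, q a ≠ 0 → 0 ≤ a) (b : Fin 3 → ℤ) :
    (fun a => n a * q (b - a)).support ⊆ Finset.Icc 0 b := by
  intro a ha
  have h := mul_ne_zero_iff.1 ha
  have h2 := hq _ h.2
  simp only [Finset.coe_Icc, Set.mem_Icc]
  exact ⟨hn a h.1, sub_nonneg.1 h2⟩

/-- The quotient of two series antisymmetric under the shifted action of `σ_i` is invariant under
`σ_i`, if the denominator restricts to `1 - e^{-α_i}` on the line through `α_i`. -/
theorem quotient_latticeRefl {n d q : (Fin 3 → ℤ) → ℤ} {i : Fin 3}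
    (hn : ∀ a, n (dotRefl i a) = -n a) (hd : ∀ a, d (dotRefl i a) = -d a)
    (hn0 : ∀ a, n a ≠ 0 → 0 ≤ a) (hq0 : ∀ a, q a ≠ 0 → 0 ≤ a)
    (hline : ∀ t : ℤ, n (Pi.single i t) = if t = 0 then 1 else if t = 1 then -1 else 0)
    (hconv : ∀ b, ∑ᶠ a, n a * q (b - a) = d b) (b : Fin 3 → ℤ) : q (latticeRefl i b) = q b := by
  -- A reflection need not preserve the support condition for formal series, so one cannot simply
  -- reflect the quotient. The induction is on `offHeight i`, which both reflections preserve.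
  obtain ⟨N, hN⟩ : ∃ N : ℕ, offHeight i b < N :=
    ⟨(offHeight i b).toNat + 1, by push_cast; have := Int.self_le_toNat (offHeight i b); omega⟩
  induction N generalizing b with
  | zero =>
    have hz : ∀ a, offHeight i a < 0 → q a = 0 := fun a ha => by
      by_contra h
      exact (offHeight_nonneg (hq0 a h)).not_gt ha
    rw [hz b (by simpa using hN),
      hz _ ((offHeight_congr fun j hj => latticeRefl_of_ne hj b).trans_lt (by simpa using hN))]
  | succ N ih =>
    set e : Fin 3 → ℤ := Pi.single i 1 with he
    have hfin : ∀ (p : (Fin 3 → ℤ) → Prop) [DecidablePred p] (x : Fin 3 → ℤ),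
        (fun a => if p a then n a * q (x - a) else 0).support.Finite := by
      intro p _ x
      refine (Finset.finite_toSet _).subset fun a ha => finite_support_conv hn0 hq0 x ?_
      exact (ite_ne_right_iff.1 ha).2
    let L : (Fin 3 → ℤ) → ℤ := fun x => ∑ᶠ a, if offHeight i a ≠ 0 then n a * q (x - a) else 0
    -- The part of the denominator in degree 0 is `1 - e^{-α_i}`; `L` collects the rest, which
    -- involves `q` only in lower degree and is antisymmetric by induction.
    have hsplit : ∀ x, q x - q (x - e) + L x = d x := by
      intro x
      have h1 : ∑ᶠ a, (if offHeight i a = 0 then n a * q (x - a) else 0) = q x - q (x - e) := by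
        have hne : (0 : Fin 3 → ℤ) ≠ e := fun h => by simpa [he] using congrFun h i
        rw [finsum_eq_sum_of_support_subset (s := {0, e}), Finset.sum_pair hne]
        · have e0 : n 0 = 1 := by simpa using hline 0
          have e1 : n e = -1 := by simpa using hline 1
          have e2 : offHeight i e = 0 :=
            Finset.sum_eq_zero fun j hj => by simp [he, Finset.ne_of_mem_erase hj]
          rw [e0, e1, e2]
          simp [offHeight]; ring
        · intro a ha
          obtain ⟨ha0, ha1⟩ := ite_ne_right_iff.1 ha
          have hna := (mul_ne_zero_iff.1 ha1).1
          have h2 := eq_single_of_offHeight_eq_zero (hn0 a hna) ha0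
          rw [h2, hline] at hna
          simp only [Finset.coe_insert, Finset.coe_singleton, Set.mem_insert_iff,
            Set.mem_singleton_iff]
          rw [h2]
          by_cases h3 : a i = 0
          · left; simp [h3]
          · by_cases h4 : a i = 1
            · right; rw [h4]
            · simp [h3, h4] at hna
      rw [← hconv x, ← h1, ← finsum_add_distrib (hfin _ x) (hfin _ x)]
      refine finsum_congr fun a => ?_
      by_cases h : offHeight i a = 0 <;> simp [h]
    have hL : ∀ x, offHeight i x < (N + 1 : ℕ) → L (dotRefl i x) = -L x := by
      intro x hx
      change ∑ᶠ a, _ = -∑ᶠ a, _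
      rw [← finsum_neg_distrib, ← finsum_comp_equiv (dotReflPerm i)]
      refine finsum_congr fun a => ?_
      change (if offHeight i (dotRefl i a) ≠ 0 then
        n (dotRefl i a) * q (dotRefl i x - dotRefl i a) else 0) = _
      rw [offHeight_congr fun j hj => dotRefl_of_ne hj a, hn, ← latticeRefl_sub]
      split_ifs with h
      · by_cases hna : n a = 0
        · simp [hna]
        · rw [ih (x - a), neg_mul]
          have := offHeight_nonneg (i := i) (hn0 a hna)
          rw [offHeight_sub]
          push_cast at hx
          omega
      · simp
    -- Adding the identities at `x` and at `dotRefl i x` cancels `L` and `d`: the defect of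
    -- invariance is constant along each `α_i`-string.
    have hstep : ∀ x, offHeight i x < (N + 1 : ℕ) →
        q (latticeRefl i (x - e)) - q (x - e) = q (latticeRefl i x) - q x := by
      intro x hx
      have h1 := hsplit x
      have h2 := hsplit (dotRefl i x)
      rw [hL x hx, hd, dotRefl_eq, ← he, add_sub_cancel_right] at h2
      have h3 : latticeRefl i (x - e) = latticeRefl i x + e := by
        rw [latticeRefl, latticeRefl, pairing_sub, he, pairing_single_self, Pi.single_sub]
        have : (Pi.single i (2 * 1) : Fin 3 → ℤ) = Pi.single i 1 + Pi.single i 1 := by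
          rw [← Pi.single_add]; rfl
        rw [this]; abel
      rw [h3]; linarith
    have hoff : ∀ t : ℤ, offHeight i (b + Pi.single i t) = offHeight i b := fun t =>
      offHeight_congr fun j hj => by simp [hj]
    have hconst : ∀ t : ℤ, q (latticeRefl i (b + Pi.single i t)) - q (b + Pi.single i t) =
        q (latticeRefl i b) - q b := by
      intro t
      induction t using Int.induction_on with
      | zero => simp
      | succ t h =>
        have hs := hstep (b + Pi.single i ((t : ℤ) + 1)) (by rwa [hoff])
        rw [← hs, ← h, Pi.single_add, ← he, ← add_assoc, add_sub_cancel_right]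
      | pred t h =>
        have hs := hstep (b + Pi.single i (-(t : ℤ))) (by rwa [hoff])
        rw [← h, ← hs, Pi.single_sub, ← he, add_sub_assoc]
    -- As the pairing is even, the string contains a vector fixed by `σ_i`, where the defect is 0.
    obtain ⟨u, hu⟩ : ∃ u, pairing b i = 2 * u := ⟨2 * b i - ∑ j, b j, by rw [pairing]; ring⟩
    have hfix := hconst (-u)
    have : latticeRefl i (b + Pi.single i (-u)) = b + Pi.single i (-u) := by
      rw [latticeRefl, pairing_add, hu, pairing_single_self]; simp
    rw [this, sub_self] at hfix
    exact (sub_eq_zero.1 hfix.symm)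

theorem form_rootVec_self (b : Fin 3 → ℕ) :
    form (rootVec b) (rootVec b) = ∑ i, (b i : ℤ) * pairing (fun j => (b j : ℤ)) i := by
  simp [form, rootVec, cartan, pairing, Fin.sum_univ_four, Fin.sum_univ_three]
  ring

theorem sum_mul_pairing_latticeRefl (i : Fin 3) (b : Fin 3 → ℤ) :
    ∑ j, latticeRefl i b j * pairing (latticeRefl i b) j = ∑ j, b j * pairing b j := by
  fin_cases i <;> simp [latticeRefl, pairing, Fin.sum_univ_three] <;> ring

/-- The support of a `W₃`-invariant function supported on nonnegative vectors consists of vectors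
of nonpositive norm. -/
theorem norm_nonpos_of_invariant {q : (Fin 3 → ℤ) → ℤ} (hq0 : ∀ a, q a ≠ 0 → 0 ≤ a)
    (hq : ∀ i b, q (latticeRefl i b) = q b) (b : Fin 3 → ℤ) (hb : q b ≠ 0) :
    ∑ i, b i * pairing b i ≤ 0 := by
  obtain ⟨N, hN⟩ : ∃ N : ℕ, ∑ j, b j ≤ N := ⟨_, Int.self_le_toNat _⟩
  induction N using Nat.strong_induction_on generalizing b with
  | _ N ih =>
    by_cases h : ∀ i, pairing b i ≤ 0
    · exact Finset.sum_nonpos fun i _ => mul_nonpos_of_nonneg_of_nonpos (hq0 b hb i) (h i)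
    · simp only [not_forall, not_le] at h
      obtain ⟨i, hi⟩ := h
      have hb' : q (latticeRefl i b) ≠ 0 := by rwa [hq]
      have hs : ∑ j, latticeRefl i b j = ∑ j, b j - pairing b i := by simp [latticeRefl]
      have hnn : 0 ≤ ∑ j, latticeRefl i b j := Finset.sum_nonneg fun j _ => hq0 _ hb' j
      rw [← sum_mul_pairing_latticeRefl i]
      exact ih (∑ j, latticeRefl i b j).toNat (by omega) _ hb' (Int.self_le_toNat _)

/-! ### Recursive division of formal series. -/

open Classical in
/-- The coefficients of the quotient of the series with coefficients `d` by that with coefficients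
`n`, where `n 0 = 1`. -/
def quotCoeff (n d : (Fin 3 → ℤ) → ℤ) (b : Fin 3 → ℤ) : ℤ :=
  if 0 ≤ b then
    d b - ∑ a ∈ ((Finset.Icc 0 b).erase 0).attach, n a * quotCoeff n d (b - a)
  else 0
termination_by (∑ i, b i).toNat
decreasing_by
  have ha := a.2
  simp only [Finset.mem_erase, Finset.mem_Icc] at ha
  obtain ⟨h0, h1, h2⟩ := ha
  have h3 : 0 < ∑ i, a.1 i := by
    obtain ⟨i, hi⟩ := Function.ne_iff.1 h0
    exact Finset.sum_pos' (fun j _ => h1 j)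
      ⟨i, Finset.mem_univ _, lt_of_le_of_ne (h1 i) (Ne.symm hi)⟩
  have h4 : ∑ i, a.1 i ≤ ∑ i, b i := Finset.sum_le_sum fun i _ => h2 i
  have h5 : ∑ i, (b - a.1) i = ∑ i, b i - ∑ i, a.1 i := by simp
  rw [h5]
  omega

theorem quotCoeff_of_nonneg (n d : (Fin 3 → ℤ) → ℤ) {b : Fin 3 → ℤ} (hb : 0 ≤ b) :
    quotCoeff n d b = d b - ∑ a ∈ (Finset.Icc 0 b).erase 0, n a * quotCoeff n d (b - a) := by
  conv_lhs => rw [quotCoeff, if_pos hb]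
  rw [Finset.sum_attach _ fun a => n a * quotCoeff n d (b - a)]

theorem nonneg_of_quotCoeff_ne_zero {n d : (Fin 3 → ℤ) → ℤ} {b : Fin 3 → ℤ}
    (h : quotCoeff n d b ≠ 0) : 0 ≤ b := by
  by_contra hb
  rw [quotCoeff, if_neg hb] at h
  exact h rfl

theorem finsum_mul_quotCoeff {n d : (Fin 3 → ℤ) → ℤ} (hn : ∀ a, n a ≠ 0 → 0 ≤ a) (hn1 : n 0 = 1)
    (hd : ∀ a, d a ≠ 0 → 0 ≤ a) (b : Fin 3 → ℤ) :
    ∑ᶠ a, n a * quotCoeff n d (b - a) = d b := by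
  rw [finsum_eq_sum_of_support_subset _
    (finite_support_conv hn (fun a ha => nonneg_of_quotCoeff_ne_zero ha) b)]
  by_cases hb : 0 ≤ b
  · rw [← Finset.add_sum_erase _ _ (Finset.mem_Icc.2 ⟨le_rfl, hb⟩), hn1, sub_zero,
      quotCoeff_of_nonneg n d hb]
    ring
  · rw [Finset.Icc_eq_empty hb, Finset.sum_empty]
    by_contra h
    exact hb (hd b (Ne.symm h))

/-! ### The coefficients of `e^{(c, s)} Z₃⁻` and of `e^{(ρ, s)} Δ₅ / 64` -/

theorem posCone_zero : PosCone 0 := ⟨le_rfl, by simp [disc]⟩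

theorem isAntidominant_zero : IsAntidominant 0 := fun i => by simp [pairing]

theorem dot_zero_injective : Function.Injective fun w : W₃ => dot w 0 := by
  rintro ⟨w, hw⟩ ⟨w', hw'⟩ h
  have h1 : dot (w'⁻¹ * w) 0 = 0 := by
    rw [map_mul, Equiv.Perm.mul_apply]
    simp only at h
    rw [h, ← Equiv.Perm.mul_apply, ← map_mul]
    simp
  have h2 := eq_one_of_dot_eq isAntidominant_zero isAntidominant_zero
    (mul_mem (inv_mem hw') hw) h1
  exact Subtype.ext (inv_mul_eq_one.1 h2).symm

/-- The coefficient of `e^{-(b, s)}` in `e^{(c, s)} Z₃⁻`. -/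
def denomCoeff : (Fin 3 → ℤ) → ℤ :=
  Function.extend (fun w : W₃ => dot w 0) (fun w => (signHom w : ℤ)) 0

theorem denomCoeff_dot (w : W₃) : denomCoeff (dot w 0) = signHom w :=
  dot_zero_injective.extend_apply _ _ w

theorem denomCoeff_of_not_exists {b : Fin 3 → ℤ} (h : ¬∃ w : W₃, dot w 0 = b) :
    denomCoeff b = 0 :=
  Function.extend_apply' _ _ _ h

theorem denomCoeff_dotRefl (i : Fin 3) (b : Fin 3 → ℤ) :
    denomCoeff (dotRefl i b) = -denomCoeff b := by
  have key : ∀ w : W₃, denomCoeff (dotRefl i (dot w 0)) = -denomCoeff (dot w 0) := by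
    intro w
    have := denomCoeff_dot ⟨cs.simple i.succ * w, mul_mem (simple_succ_mem i) w.2⟩
    simp only [map_mul, Equiv.Perm.mul_apply, dot_simple, signHom_simple] at this
    rw [this, denomCoeff_dot]
    simp
  by_cases h : ∃ w : W₃, dot w 0 = b
  · obtain ⟨w, rfl⟩ := h
    exact key w
  · rw [denomCoeff_of_not_exists h, neg_zero]
    refine denomCoeff_of_not_exists ?_
    rintro ⟨w, hw⟩
    refine h ⟨⟨cs.simple i.succ * w, mul_mem (simple_succ_mem i) w.2⟩, ?_⟩
    rw [map_mul, Equiv.Perm.mul_apply, dot_simple, hw, dotRefl_dotRefl]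

theorem nonneg_of_denomCoeff_ne_zero (b : Fin 3 → ℤ) (h : denomCoeff b ≠ 0) : 0 ≤ b := by
  by_contra hb
  refine h (denomCoeff_of_not_exists ?_)
  rintro ⟨w, rfl⟩
  exact hb (posCone_zero.dot w.2).1

theorem abs_denomCoeff_le (b : Fin 3 → ℤ) : |(denomCoeff b : ℝ)| ≤ 1 := by
  by_cases h : ∃ w : W₃, dot w 0 = b
  · obtain ⟨w, rfl⟩ := h
    rw [denomCoeff_dot]
    rcases Int.units_eq_one_or (signHom (w : W)) with h | h <;> simp [h]
  · simp [denomCoeff_of_not_exists h]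

theorem denomCoeff_zero : denomCoeff 0 = 1 := by
  simpa using denomCoeff_dot 1

theorem dotRefl_single (i : Fin 3) (t : ℤ) :
    dotRefl i (Pi.single i t) = Pi.single i (1 - t) := by
  rw [dotRefl_eq, latticeRefl, pairing_single_self, ← Pi.single_sub, ← Pi.single_add]
  congr 1; ring

/-- The dot reflection exchanges `t` and `1 - t`, and the support is nonnegative, so only `t = 0, 1`
survive. This supplies the hypothesis `hline` of `quotient_latticeRefl`. -/
theorem denomCoeff_single (i : Fin 3) (t : ℤ) :
    denomCoeff (Pi.single i t) = if t = 0 then 1 else if t = 1 then -1 else 0 := by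
  have h := denomCoeff_dotRefl i (Pi.single i t)
  rw [dotRefl_single] at h
  split_ifs with h0 h1
  · simp [h0, denomCoeff_zero]
  · rw [h1] at h ⊢
    simp only [sub_self, Pi.single_zero, denomCoeff_zero] at h
    linarith
  · by_contra hne
    have hne' : denomCoeff (Pi.single i (1 - t)) ≠ 0 := by rw [h]; simpa using hne
    have h2 := nonneg_of_denomCoeff_ne_zero _ hne i
    have h3 := nonneg_of_denomCoeff_ne_zero _ hne' i
    simp at h2 h3
    omega

open Classical in
/-- The coefficient of `e^{-(b, s)}` in `e^{(ρ, s)} Δ₅ / 64`. -/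
def numerCoeff (b : Fin 3 → ℤ) : ℤ := if PosCone b then fourierCoeff b else 0

theorem numerCoeff_of_posCone {b : Fin 3 → ℤ} (h : PosCone b) : numerCoeff b = fourierCoeff b :=
  if_pos h

theorem numerCoeff_of_not_posCone {b : Fin 3 → ℤ} (h : ¬PosCone b) : numerCoeff b = 0 :=
  if_neg h

theorem numerCoeff_dotRefl (i : Fin 3) (b : Fin 3 → ℤ) :
    numerCoeff (dotRefl i b) = -numerCoeff b := by
  by_cases h : PosCone b
  · rw [numerCoeff_of_posCone h, numerCoeff_of_posCone (h.dotRefl i), fourierCoeff_dotRefl]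
  · have h' : ¬PosCone (dotRefl i b) := fun h' => h (by simpa [dotRefl_dotRefl] using h'.dotRefl i)
    rw [numerCoeff_of_not_posCone h, numerCoeff_of_not_posCone h', neg_zero]

theorem nonneg_of_numerCoeff_ne_zero (b : Fin 3 → ℤ) (h : numerCoeff b ≠ 0) : 0 ≤ b := by
  by_contra hb
  exact h (numerCoeff_of_not_posCone fun h' => hb h'.1)

/-- The coefficients of the quotient `e^{(ρ, s)} Δ₅ / (64 e^{(c, s)} Z₃⁻)`. -/
abbrev quotientCoeff : (Fin 3 → ℤ) → ℤ := quotCoeff denomCoeff numerCoeff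

theorem finsum_mul_quotientCoeff (b : Fin 3 → ℤ) :
    ∑ᶠ a, denomCoeff a * quotientCoeff (b - a) = numerCoeff b :=
  finsum_mul_quotCoeff nonneg_of_denomCoeff_ne_zero denomCoeff_zero nonneg_of_numerCoeff_ne_zero b

theorem form_nonpos_of_quotientCoeff_ne_zero (b : Fin 3 → ℕ)
    (h : quotientCoeff (fun i => (b i : ℤ)) ≠ 0) : form (rootVec b) (rootVec b) ≤ 0 := by
  rw [form_rootVec_self]
  have hq0 : ∀ a, quotientCoeff a ≠ 0 → 0 ≤ a := fun a ha => nonneg_of_quotCoeff_ne_zero ha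
  exact norm_nonpos_of_invariant hq0
    (fun i => quotient_latticeRefl (denomCoeff_dotRefl i) (numerCoeff_dotRefl i)
      nonneg_of_denomCoeff_ne_zero hq0 (denomCoeff_single i) finsum_mul_quotientCoeff) _ h

/-! ### Growth of the coefficients of the quotient -/

/-- The height of a lattice vector. -/
def height (b : Fin 3 → ℤ) : ℕ := (∑ i, b i).toNat

theorem natCast_height {b : Fin 3 → ℤ} (hb : 0 ≤ b) : (height b : ℤ) = ∑ i, b i :=
  Int.toNat_of_nonneg (Finset.sum_nonneg fun i _ => hb i)

theorem height_sub_add {a b : Fin 3 → ℤ} (ha : 0 ≤ a) (hab : a ≤ b) :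
    height (b - a) + height a = height b := by
  have h1 := natCast_height ha
  have h2 := natCast_height (ha.trans hab)
  have h3 := natCast_height (sub_nonneg.2 hab)
  simp only [Pi.sub_apply, Finset.sum_sub_distrib] at h3
  omega

theorem height_natCast (b : Fin 3 → ℕ) : height (fun i => (b i : ℤ)) = ∑ i, b i := by
  rw [height, ← Nat.cast_sum, Int.toNat_natCast]

/-- The sum over all nonnegative vectors is `(8/7)³ < 3/2`, and the zero vector takes away 1; this
is why the base 8 is used. -/
theorem sum_pow_height_le {F : Finset (Fin 3 → ℤ)} (hF : ∀ a ∈ F, 0 ≤ a ∧ a ≠ 0) :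
    ∑ a ∈ F, (1 / 8 : ℝ) ^ height a ≤ 1 / 2 := by
  have hinv : ∀ a ∈ F, (fun i => (((a i).toNat : ℕ) : ℤ)) = a := fun a ha =>
    funext fun i => Int.toNat_of_nonneg ((hF a ha).1 i)
  have hinj : Set.InjOn (fun (a : Fin 3 → ℤ) i => (a i).toNat) F := by
    intro a ha b hb h
    rw [← hinv a ha, ← hinv b hb]
    funext i
    exact congrArg Nat.cast (congrFun h i)
  have h0 : (0 : Fin 3 → ℕ) ∉ F.image fun (a : Fin 3 → ℤ) i => (a i).toNat := by
    intro h
    obtain ⟨a, ha, h⟩ := Finset.mem_image.1 h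
    refine (hF a ha).2 ?_
    rw [← hinv a ha]
    funext i
    simpa using congrArg (Nat.cast (R := ℤ)) (congrFun h i)
  have h1 := sum_pow_le (r := 1 / 8) (by norm_num) (by norm_num)
    (insert 0 (F.image fun (a : Fin 3 → ℤ) i => (a i).toNat))
  rw [Finset.sum_insert h0, Finset.sum_image hinj] at h1
  have h2 : ∑ a ∈ F, (1 / 8 : ℝ) ^ height a = ∑ a ∈ F, (1 / 8 : ℝ) ^ ∑ i, (a i).toNat := by
    refine Finset.sum_congr rfl fun a ha => ?_
    rw [← height_natCast, hinv a ha]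
  rw [h2]
  norm_num at h1 ⊢
  linarith

theorem exists_abs_numerCoeff_le :
    ∃ C : ℝ, 0 < C ∧ ∀ b, |(numerCoeff b : ℝ)| ≤ C * 8 ^ height b := by
  obtain ⟨C, hC0, hC⟩ := exists_abs_fourierCoeff_le
  -- From `y^11 ≤ 11! e^y` at `y = height b + 1`, together with `e ≤ 8`.
  refine ⟨C * ((Nat.factorial 11 : ℕ) * Real.exp 1), by positivity, fun b => ?_⟩
  by_cases hb : PosCone b
  · rw [numerCoeff_of_posCone hb]
    refine (hC b hb).trans ?_
    rw [← natCast_height hb.1, mul_assoc]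
    gcongr
    have h := Real.pow_div_factorial_le_exp ((height b : ℝ) + 1) (by positivity) 11
    rw [div_le_iff₀ (by positivity), Real.exp_add] at h
    have h2 : Real.exp (height b) ≤ 8 ^ height b := by
      rw [← Real.exp_one_pow]
      gcongr
      linarith [Real.exp_one_lt_d9]
    calc (((height b : ℤ) : ℝ) + 1) ^ 11 = ((height b : ℝ) + 1) ^ 11 := by push_cast; rfl
      _ ≤ _ := h
      _ ≤ 8 ^ height b * Real.exp 1 * (Nat.factorial 11 : ℕ) := by gcongr
      _ = _ := by ring
  · rw [numerCoeff_of_not_posCone hb]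
    simp
    positivity

/-- Induction along the recursion: the numerator contributes half of the bound `2C · 8^height`, and
by `sum_pow_height_le` the terms with `a ≠ 0` contribute at most the other half. -/
theorem exists_abs_quotientCoeff_le :
    ∃ C : ℝ, 0 < C ∧ ∀ b, |(quotientCoeff b : ℝ)| ≤ C * 8 ^ height b := by
  obtain ⟨C, hC0, hC⟩ := exists_abs_numerCoeff_le
  refine ⟨2 * C, by positivity, fun b => ?_⟩
  induction hk : height b using Nat.strong_induction_on generalizing b with
  | _ k ih =>
    by_cases hb : 0 ≤ b
    · have hmem : ∀ a ∈ (Finset.Icc 0 b).erase 0, 0 ≤ a ∧ a ≠ 0 := fun a ha => by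
        rw [Finset.mem_erase, Finset.mem_Icc] at ha
        exact ⟨ha.2.1, ha.1⟩
      rw [quotientCoeff, quotCoeff_of_nonneg _ _ hb]
      have hsum : |((∑ a ∈ (Finset.Icc 0 b).erase 0,
          denomCoeff a * quotCoeff denomCoeff numerCoeff (b - a) : ℤ) : ℝ)| ≤ C * 8 ^ k := by
        rw [Int.cast_sum]
        refine (Finset.abs_sum_le_sum_abs _ _).trans ?_
        calc _ ≤ ∑ a ∈ (Finset.Icc 0 b).erase 0, 2 * C * 8 ^ k * (1 / 8 : ℝ) ^ height a := by
              refine Finset.sum_le_sum fun a ha => ?_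
              obtain ⟨ha0, hane⟩ := hmem a ha
              have hab : a ≤ b := (Finset.mem_Icc.1 (Finset.mem_of_mem_erase ha)).2
              have hh := height_sub_add ha0 hab
              have hpos : 0 < height a := by
                have h1 := natCast_height ha0
                obtain ⟨i, hi⟩ := Function.ne_iff.1 hane
                have : 0 < ∑ i, a i := Finset.sum_pos' (fun j _ => ha0 j)
                  ⟨i, Finset.mem_univ _, lt_of_le_of_ne (ha0 i) (Ne.symm hi)⟩
                omega
              rw [Int.cast_mul, abs_mul]
              calc _ ≤ 1 * (2 * C * 8 ^ height (b - a)) := by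
                    gcongr
                    · exact abs_denomCoeff_le a
                    · exact ih _ (by omega) (b - a) rfl
                _ = _ := by
                    rw [← hk, ← hh, pow_add, one_div, inv_pow]
                    field_simp
          _ = 2 * C * 8 ^ k * ∑ a ∈ (Finset.Icc 0 b).erase 0, (1 / 8 : ℝ) ^ height a := by
              rw [Finset.mul_sum]
          _ ≤ 2 * C * 8 ^ k * (1 / 2) := by
              gcongr
              exact sum_pow_height_le hmem
          _ = _ := by ring
      rw [Int.cast_sub]
      refine (abs_sub _ _).trans ?_
      have := hC b
      rw [hk] at this
      linarith
    · have : quotientCoeff b = 0 := by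
        by_contra h
        exact hb (nonneg_of_quotCoeff_ne_zero h)
      rw [this]
      simp
      positivity

/-- The threshold 3 is chosen for `e^(-3) ≤ 1/16`, which beats the growth `8^height` of the quotient
coefficients by a factor 2 per unit of height. -/
theorem norm_latticeExp_le {s : Fin 4 → ℂ} (hs : ∀ i : Fin 3, 3 < (form (α i.succ) s).re)
    {a : Fin 3 → ℤ} (ha : 0 ≤ a) : ‖latticeExp s a‖ ≤ (1 / 16 : ℝ) ^ height a := by
  have h1 : ((height a : ℕ) : ℝ) = ∑ i, (a i : ℝ) := by exact_mod_cast natCast_height ha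
  have h2 : (height a : ℝ) * 3 ≤ ∑ i, (a i : ℝ) * (form (α i.succ) s).re := by
    rw [h1, Finset.sum_mul]
    exact Finset.sum_le_sum fun i _ =>
      mul_le_mul_of_nonneg_left (hs i).le (by exact_mod_cast ha i)
  have h3 : Real.exp (-3) ≤ 1 / 16 := by
    rw [Real.exp_neg, one_div]
    refine inv_anti₀ (by norm_num) ?_
    have : Real.exp 3 = Real.exp 1 ^ 3 := by rw [← Real.exp_nat_mul]; norm_num
    rw [this]
    calc (16 : ℝ) ≤ 2.7 ^ 3 := by norm_num
      _ ≤ _ := by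
        gcongr
        linarith [Real.exp_one_gt_d9]
  calc ‖latticeExp s a‖ ≤ Real.exp (height a * (-3)) := by
        rw [norm_latticeExp]
        gcongr
        linarith
    _ = Real.exp (-3) ^ height a := Real.exp_nat_mul _ _
    _ ≤ _ := by gcongr

/-! ### Convergence and comparison of the series -/

/-- The product of two lattice sums, in terms of the convolution of the coefficients. -/
theorem tsum_mul_tsum_latticeExp {n q d : (Fin 3 → ℤ) → ℤ} {s : Fin 4 → ℂ}
    (hn0 : ∀ a, n a ≠ 0 → 0 ≤ a) (hq0 : ∀ a, q a ≠ 0 → 0 ≤ a)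
    (hconv : ∀ b, ∑ᶠ a, n a * q (b - a) = d b)
    (hn : Summable fun b => (n b : ℂ) * latticeExp s b)
    (hq : Summable fun b => (q b : ℂ) * latticeExp s b) :
    (∑' b, (n b : ℂ) * latticeExp s b) * ∑' b, (q b : ℂ) * latticeExp s b =
      ∑' b, (d b : ℂ) * latticeExp s b := by
  let e : (Fin 3 → ℤ) × (Fin 3 → ℤ) ≃ (Fin 3 → ℤ) × (Fin 3 → ℤ) :=
    { toFun := fun p => (p.2, p.1 - p.2)
      invFun := fun p => (p.1 + p.2, p.1)
      left_inv := fun p => by simp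
      right_inv := fun p => by simp }
  have hs := summable_mul_of_summable_norm hn.norm hq.norm
  rw [tsum_mul_tsum_of_summable_norm hn.norm hq.norm, ← e.tsum_eq]
  refine (Summable.tsum_prod (e.summable_iff.2 hs)).trans (tsum_congr fun b => ?_)
  have hterm : ∀ a, (n a : ℂ) * latticeExp s a * ((q (b - a) : ℂ) * latticeExp s (b - a)) =
      ((n a * q (b - a) : ℤ) : ℂ) * latticeExp s b := by
    intro a
    have : latticeExp s b = latticeExp s a * latticeExp s (b - a) := by
      rw [← latticeExp_add, add_sub_cancel]
    rw [this]
    push_cast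
    ring
  change ∑' a, (n a : ℂ) * latticeExp s a * ((q (b - a) : ℂ) * latticeExp s (b - a)) = _
  simp only [hterm]
  rw [tsum_mul_right]
  congr 1
  rw [← hconv b, finsum_eq_sum_of_support_subset _ (finite_support_conv hn0 hq0 b), Int.cast_sum]
  refine tsum_eq_sum fun a ha => ?_
  by_contra h
  exact ha (finite_support_conv hn0 hq0 b (by simpa using h))

/-- The multiplicity of an antidominant vector: minus its Fourier coefficient, and `0` at `0`. -/
def multiplicity (a : Antidominant) : ℤ :=
  (if a.coeffs = 0 then 1 else 0) - fourierCoeff a.coeffs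

theorem abs_multiplicity_le (a : Antidominant) : |multiplicity a| ≤ |fourierCoeff a.coeffs| := by
  rw [multiplicity]
  split_ifs with h
  · simp [h, fourierCoeff_zero]
  · simp

theorem latticeVec_zero : latticeVec 0 = 0 := by
  ext i
  fin_cases i <;> simp [latticeVec, toC]

theorem exp_mul_altTerm_self {c : Fin 4 → ℂ} (h1 : c 1 = c 2) (h2 : c 2 = c 3)
    (h3 : 2 * c 0 + 2 * c 1 = 1) (s : Fin 4 → ℂ) (w : W₃) :
    Complex.exp (form c s) * altTerm c s w = ((signHom w : ℤ) : ℂ) * latticeExp s (dot w 0) := by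
  have := exp_mul_altTerm h1 h2 h3 s 0 w.2
  rwa [latticeVec_zero, add_zero] at this

theorem summable_altTerm_iff {c : Fin 4 → ℂ} (h1 : c 1 = c 2) (h2 : c 2 = c 3)
    (h3 : 2 * c 0 + 2 * c 1 = 1) (s : Fin 4 → ℂ) :
    Summable (fun w : W₃ => altTerm c s w) ↔
      Summable fun b => (denomCoeff b : ℂ) * latticeExp s b := by
  rw [← summable_mul_left_iff (Complex.exp_ne_zero (form c s)),
    ← dot_zero_injective.summable_iff]
  · refine summable_congr fun w => ?_
    rw [exp_mul_altTerm_self h1 h2 h3, Function.comp_apply, denomCoeff_dot]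
  · intro b hb
    rw [denomCoeff_of_not_exists hb]
    simp

theorem exp_mul_altSum {c : Fin 4 → ℂ} (h1 : c 1 = c 2) (h2 : c 2 = c 3)
    (h3 : 2 * c 0 + 2 * c 1 = 1) (s : Fin 4 → ℂ) :
    Complex.exp (form c s) * altSum c s = ∑' b, (denomCoeff b : ℂ) * latticeExp s b := by
  rw [altSum, ← tsum_mul_left, ← dot_zero_injective.tsum_eq]
  · refine tsum_congr fun w => ?_
    rw [exp_mul_altTerm_self h1 h2 h3, denomCoeff_dot]
  · intro b hb
    by_contra h
    exact hb (by simp [denomCoeff_of_not_exists h])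

theorem summable_denomCoeff {t : Fin 3 → ℝ} {s : Fin 4 → ℂ}
    (ht : ∀ i, t i = (form (α i.succ) s).re) (ht1 : 0 < t 0 + t 2)
    (ht2 : 0 < t 0 * t 1 + t 0 * t 2 + t 1 * t 2) :
    Summable fun b => (denomCoeff b : ℂ) * latticeExp s b := by
  rw [← Subtype.val_injective (p := PosCone) |>.summable_iff]
  · refine summable_mul_latticeExp (C := 1) (k := 0) ht ht1 ht2 fun b => ?_
    simpa using abs_denomCoeff_le b.1
  · intro b hb
    have : denomCoeff b = 0 := denomCoeff_of_not_exists fun ⟨w, hw⟩ =>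
      hb ⟨⟨b, hw ▸ posCone_zero.dot w.2⟩, rfl⟩
    simp [this]

theorem summable_fourierCoeff {t : Fin 3 → ℝ} {s : Fin 4 → ℂ}
    (ht : ∀ i, t i = (form (α i.succ) s).re) (ht1 : 0 < t 0 + t 2)
    (ht2 : 0 < t 0 * t 1 + t 0 * t 2 + t 1 * t 2) :
    Summable fun b : {b // PosCone b} => (fourierCoeff b : ℂ) * latticeExp s b := by
  obtain ⟨C, -, hC⟩ := exists_abs_fourierCoeff_le
  exact summable_mul_latticeExp ht ht1 ht2 fun b => hC b.1 b.2

theorem tsum_numerCoeff (s : Fin 4 → ℂ) :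
    ∑' b, (numerCoeff b : ℂ) * latticeExp s b =
      ∑' b : {b // PosCone b}, (fourierCoeff b : ℂ) * latticeExp s b := by
  rw [← Subtype.val_injective (p := PosCone) |>.tsum_eq]
  · exact tsum_congr fun b => by rw [numerCoeff_of_posCone b.2]
  · intro b hb
    by_contra h
    exact hb (by simp [numerCoeff_of_not_posCone fun hc => h ⟨⟨b, hc⟩, rfl⟩])

theorem exp_mul_Delta5 {z₀ z₁ z₂ z₃ : ℂ} {s : Fin 4 → ℂ} {Z : Matrix (Fin 2) (Fin 2) ℂ}
    (hs : s = sVec z₀ z₁ z₂ z₃) (hZ : Z = (1 / (Real.pi * Complex.I) : ℂ) • !![z₁, z₂; z₂, z₃]) :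
    Complex.exp (form ρ s) / 64 * Delta5 Z =
      ∑' b : {b // PosCone b}, (fourierCoeff b : ℂ) * latticeExp s b := by
  rw [Delta5, ← mul_assoc, div_mul_cancel₀ _ (by norm_num), ← tsum_mul_left,
    ← posConeEquiv.tsum_eq]
  exact tsum_congr fun b => deltaTerm_posConeEquiv hs hZ b

theorem summable_deltaTerm_iff {z₀ z₁ z₂ z₃ : ℂ} {s : Fin 4 → ℂ} {Z : Matrix (Fin 2) (Fin 2) ℂ}
    (hs : s = sVec z₀ z₁ z₂ z₃) (hZ : Z = (1 / (Real.pi * Complex.I) : ℂ) • !![z₁, z₂; z₂, z₃]) :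
    Summable (deltaTerm Z) ↔
      Summable fun b : {b // PosCone b} => (fourierCoeff b : ℂ) * latticeExp s b := by
  rw [← summable_mul_left_iff (Complex.exp_ne_zero (form ρ s)), ← posConeEquiv.summable_iff]
  exact summable_congr fun b => deltaTerm_posConeEquiv hs hZ b

/-- The sign of `w` is absorbed by the antisymmetry of `fourierCoeff`, so the pair `(a, w)`
contributes exactly the Fourier term at `dot w a`. -/
theorem exp_mul_coeff_mul_altTerm {c : Fin 4 → ℂ} (h1 : c 1 = c 2) (h2 : c 2 = c 3)
    (h3 : 2 * c 0 + 2 * c 1 = 1) (s : Fin 4 → ℂ) (p : Antidominant × W₃) :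
    Complex.exp (form c s) * ((fourierCoeff p.1.coeffs : ℂ) *
        altTerm (c + toC (rootVec p.1.1)) s p.2) =
      (fourierCoeff (chamberEquiv p : Fin 3 → ℤ) : ℂ) *
        latticeExp s (chamberEquiv p : Fin 3 → ℤ) := by
  have := exp_mul_altTerm h1 h2 h3 s p.1.coeffs p.2.2
  rw [mul_left_comm]
  change _ * (_ * altTerm (c + latticeVec p.1.coeffs) s p.2) = _
  rw [this, chamberEquiv_apply, fourierCoeff_dot _ p.2.2]
  push_cast
  ring

theorem summable_coeff_mul_altTerm {c : Fin 4 → ℂ} (h1 : c 1 = c 2) (h2 : c 2 = c 3)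
    (h3 : 2 * c 0 + 2 * c 1 = 1) {s : Fin 4 → ℂ}
    (hs : Summable fun b : {b // PosCone b} => (fourierCoeff b : ℂ) * latticeExp s b) :
    Summable fun p : Antidominant × W₃ => (fourierCoeff p.1.coeffs : ℂ) *
      altTerm (c + toC (rootVec p.1.1)) s p.2 := by
  rw [← summable_mul_left_iff (Complex.exp_ne_zero (form c s))]
  exact (summable_congr (exp_mul_coeff_mul_altTerm h1 h2 h3 s)).2 (chamberEquiv.summable_iff.2 hs)

theorem summable_multiplicity_mul_altTerm {c : Fin 4 → ℂ} (h1 : c 1 = c 2) (h2 : c 2 = c 3)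
    (h3 : 2 * c 0 + 2 * c 1 = 1) {s : Fin 4 → ℂ}
    (hs : Summable fun b : {b // PosCone b} => (fourierCoeff b : ℂ) * latticeExp s b) :
    Summable fun p : Antidominant × W₃ => (multiplicity p.1 : ℂ) *
      altTerm (c + toC (rootVec p.1.1)) s p.2 := by
  refine Summable.of_norm_bounded (summable_coeff_mul_altTerm h1 h2 h3 hs).norm fun p => ?_
  rw [norm_mul, norm_mul]
  gcongr
  rw [Complex.norm_intCast, Complex.norm_intCast]
  exact_mod_cast abs_multiplicity_le p.1

theorem exp_mul_altSum_sub {c : Fin 4 → ℂ} (h1 : c 1 = c 2) (h2 : c 2 = c 3)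
    (h3 : 2 * c 0 + 2 * c 1 = 1) {s : Fin 4 → ℂ}
    (hs : Summable fun b : {b // PosCone b} => (fourierCoeff b : ℂ) * latticeExp s b) :
    Complex.exp (form c s) * (altSum c s - ∑' a : Antidominant, (multiplicity a : ℂ) *
        altSum (c + toC (rootVec a.1)) s) =
      ∑' b : {b // PosCone b}, (fourierCoeff b : ℂ) * latticeExp s b := by
  have hm := summable_multiplicity_mul_altTerm h1 h2 h3 hs
  have hf := summable_coeff_mul_altTerm h1 h2 h3 hs
  have hmS : Summable fun a : Antidominant => (multiplicity a : ℂ) *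
      altSum (c + toC (rootVec a.1)) s := by
    refine hm.prod.congr fun a => ?_
    rw [altSum, ← tsum_mul_left]
  let a₀ : Antidominant := ⟨0, fun i => by rw [form_rootVec]; simp [pairing]⟩
  have ha₀ : ∀ a : Antidominant, a.coeffs = 0 ↔ a = a₀ := by
    intro a
    constructor
    · intro h
      refine Subtype.ext (funext fun i => ?_)
      have := congrFun h i
      simpa [Antidominant.coeffs, a₀] using this
    · rintro rfl
      funext i
      simp [Antidominant.coeffs, a₀]
  have hc : altSum (c + toC (rootVec a₀.1)) s = altSum c s := by
    have : toC (rootVec a₀.1) = 0 := by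
      ext i
      fin_cases i <;> simp [toC, rootVec, a₀]
    rw [this, add_zero]
  -- `Z₃⁻` is the summand `a = 0`, since `fourierCoeff 0 = 1`; the other coefficients are `-m(a)`.
  have key : altSum c s - ∑' a : Antidominant, (multiplicity a : ℂ) *
      altSum (c + toC (rootVec a.1)) s = ∑' a : Antidominant, (fourierCoeff a.coeffs : ℂ) *
        altSum (c + toC (rootVec a.1)) s := by
    classical
    have hδ := hasSum_ite_eq a₀ (altSum c s)
    rw [← hδ.tsum_eq, ← hδ.summable.tsum_sub hmS]
    refine tsum_congr fun a => ?_
    rw [multiplicity]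
    by_cases h : a = a₀
    · subst h
      rw [if_pos rfl, if_pos ((ha₀ _).2 rfl), hc]
      push_cast
      ring
    · rw [if_neg h, if_neg (mt (ha₀ a).1 h)]
      push_cast
      ring
  rw [key, ← chamberEquiv.tsum_eq, ← tsum_congr (exp_mul_coeff_mul_altTerm h1 h2 h3 s),
    tsum_mul_left, hf.tsum_prod]
  congr 1
  refine tsum_congr fun a => ?_
  rw [altSum, ← tsum_mul_left]

theorem natCast_comp_injective :
    Function.Injective fun (b : Fin 3 → ℕ) (i : Fin 3) => (b i : ℤ) :=
  fun a b h => funext fun i => by simpa using congrFun h i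

theorem quotientCoeff_eq_zero_of_notMem_range {b : Fin 3 → ℤ}
    (hb : b ∉ Set.range fun (b : Fin 3 → ℕ) (i : Fin 3) => (b i : ℤ)) : quotientCoeff b = 0 := by
  by_contra h
  exact hb ⟨fun i => (b i).toNat, funext fun i =>
    Int.toNat_of_nonneg (nonneg_of_quotCoeff_ne_zero h i)⟩

theorem summable_quotientCoeff_iff (s : Fin 4 → ℂ) :
    Summable (fun b : Fin 3 → ℕ => (quotientCoeff (fun i => (b i : ℤ)) : ℂ) *
        Complex.exp (-form (toC (rootVec b)) s)) ↔
      Summable fun b => (quotientCoeff b : ℂ) * latticeExp s b := by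
  rw [← natCast_comp_injective.summable_iff]
  · rfl
  · intro b hb
    rw [quotientCoeff_eq_zero_of_notMem_range hb]
    simp

theorem tsum_quotientCoeff (s : Fin 4 → ℂ) :
    ∑' b : Fin 3 → ℕ, (quotientCoeff (fun i => (b i : ℤ)) : ℂ) *
        Complex.exp (-form (toC (rootVec b)) s) =
      ∑' b, (quotientCoeff b : ℂ) * latticeExp s b := by
  rw [← natCast_comp_injective.tsum_eq]
  · rfl
  · intro b hb
    by_contra h
    exact hb (by simp [quotientCoeff_eq_zero_of_notMem_range h])

theorem summable_quotientCoeff_of_lt {s : Fin 4 → ℂ}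
    (hs : ∀ i : Fin 3, 3 < (form (α i.succ) s).re) :
    Summable fun b : Fin 3 → ℕ => (quotientCoeff (fun i => (b i : ℤ)) : ℂ) *
        Complex.exp (-form (toC (rootVec b)) s) := by
  obtain ⟨C, hC0, hC⟩ := exists_abs_quotientCoeff_le
  refine Summable.of_norm_bounded ((summable_pow_sum (r := 1 / 2) (by norm_num)
    (by norm_num)).mul_left C) fun b => ?_
  have h1 := norm_latticeExp_le hs (a := fun i => (b i : ℤ)) fun i => Int.natCast_nonneg _
  have h2 := hC fun i => (b i : ℤ)
  rw [height_natCast] at h1 h2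
  change ‖_ * latticeExp s fun i => (b i : ℤ)‖ ≤ _
  rw [norm_mul, Complex.norm_intCast]
  calc _ ≤ C * 8 ^ (∑ i, b i) * (1 / 16 : ℝ) ^ (∑ i, b i) := by gcongr
    _ = C * (1 / 2) ^ (∑ i, b i) := by rw [mul_assoc, ← mul_pow]; norm_num

/-- The constant term is 1, and all other terms together have norm at most 1/2. -/
theorem tsum_denomCoeff_ne_zero_of_lt {s : Fin 4 → ℂ}
    (hs : ∀ i : Fin 3, 3 < (form (α i.succ) s).re)
    (hsum : Summable fun b => (denomCoeff b : ℂ) * latticeExp s b) :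
    ∑' b, (denomCoeff b : ℂ) * latticeExp s b ≠ 0 := by
  have hbound : ‖∑' b, (denomCoeff b : ℂ) * latticeExp s b - 1‖ ≤ 1 / 2 := by
    have hlim := (hsum.hasSum.sub_const 1).norm
    refine le_of_tendsto hlim ?_
    filter_upwards [Filter.eventually_ge_atTop {0}] with F hF
    have h0 : (0 : Fin 3 → ℤ) ∈ F := hF (Finset.mem_singleton_self 0)
    rw [← Finset.add_sum_erase _ _ h0, denomCoeff_zero, latticeExp_zero, Int.cast_one, mul_one,
      add_sub_cancel_left]
    classical
    rw [← Finset.sum_filter_of_ne (p := fun b => 0 ≤ b) fun b _ hb =>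
      nonneg_of_denomCoeff_ne_zero b (by simpa using left_ne_zero_of_mul hb)]
    refine (norm_sum_le _ _).trans ?_
    have hmem : ∀ a ∈ (F.erase 0).filter (fun b => 0 ≤ b), 0 ≤ a ∧ a ≠ 0 := fun a ha => by
      rw [Finset.mem_filter, Finset.mem_erase] at ha
      exact ⟨ha.2, ha.1.1⟩
    refine (Finset.sum_le_sum fun a ha => ?_).trans (sum_pow_height_le hmem)
    rw [norm_mul, Complex.norm_intCast]
    calc _ ≤ 1 * (1 / 16 : ℝ) ^ height a := by
          gcongr
          · exact abs_denomCoeff_le a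
          · exact norm_latticeExp_le hs (hmem a ha).1
      _ ≤ _ := by rw [one_mul]; gcongr; norm_num
  intro h
  rw [h] at hbound
  norm_num at hbound

end Apollonian

end

/-! ### The two statements assembled. -/

theorem theorem3p1 :
    ∃ (m : Apollonian.Antidominant → ℤ) (q : (Fin 3 → ℕ) → ℤ),
      -- the exponents that occur in the series of the second statement
      (∀ b : Fin 3 → ℕ, q b ≠ 0 →
        Apollonian.form (Apollonian.rootVec b) (Apollonian.rootVec b) ≤ 0) ∧
      ∃ R : ℝ, ∀ c : Fin 4 → ℝ, c 1 = c 2 → c 2 = c 3 → 2 * c 0 + 2 * c 1 = 1 →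
        ∀ z₀ z₁ z₂ z₃ : ℂ, ∀ s C : Fin 4 → ℂ, ∀ Z : Matrix (Fin 2) (Fin 2) ℂ,
          s = Apollonian.sVec z₀ z₁ z₂ z₃ → C = (fun i => (c i : ℂ)) →
          Z = (1 / (Real.pi * Complex.I) : ℂ) • !![z₁, z₂; z₂, z₃] →
          (Z ∈ Apollonian.siegelH →
            -- absolute convergence of the three series of the first statement
            Summable (Apollonian.deltaTerm Z) ∧
            Summable (fun w : Apollonian.W₃ => Apollonian.altTerm C s w) ∧
            Summable (fun p : Apollonian.Antidominant × Apollonian.W₃ => (m p.1 : ℂ) *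
              Apollonian.altTerm (C + Apollonian.toC (Apollonian.rootVec p.1.1)) s p.2) ∧
            -- the first statement
            Complex.exp (Apollonian.form C s) * (Apollonian.altSum C s -
                ∑' a : Apollonian.Antidominant, (m a : ℂ) *
                  Apollonian.altSum (C + Apollonian.toC (Apollonian.rootVec a.1)) s) =
              Complex.exp (Apollonian.form Apollonian.ρ s) / 64 * Apollonian.Delta5 Z ∧
            -- the second statement, wherever the series converges absolutely
            (Summable (fun b : Fin 3 → ℕ => (q b : ℂ) *
                Complex.exp (-Apollonian.form (Apollonian.toC (Apollonian.rootVec b)) s)) →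
              Apollonian.altSum C s ≠ 0 →
              Complex.exp (Apollonian.form Apollonian.ρ s) * Apollonian.Delta5 Z /
                  (64 * Complex.exp (Apollonian.form C s) * Apollonian.altSum C s) =
                ∑' b : Fin 3 → ℕ, (q b : ℂ) *
                  Complex.exp (-Apollonian.form (Apollonian.toC (Apollonian.rootVec b)) s))) ∧
          -- the region `Re (α_i, s) > R`, where the second statement is an identity of functions
          ((∀ i : Fin 3, R < (Apollonian.form (Apollonian.α i.succ) s).re) →
            Z ∈ Apollonian.siegelH ∧ Apollonian.altSum C s ≠ 0 ∧
            Summable (fun b : Fin 3 → ℕ => (q b : ℂ) *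
                Complex.exp (-Apollonian.form (Apollonian.toC (Apollonian.rootVec b)) s))) := by
  refine ⟨Apollonian.multiplicity, fun b => Apollonian.quotientCoeff fun i => (b i : ℤ),
    Apollonian.form_nonpos_of_quotientCoeff_ne_zero, 3, ?_⟩
  intro c hc1 hc2 hc3 z₀ z₁ z₂ z₃ s C Z hs hC hZ
  have h1 : C 1 = C 2 := by rw [hC]; exact congrArg _ hc1
  have h2 : C 2 = C 3 := by rw [hC]; exact congrArg _ hc2
  have h3 : 2 * C 0 + 2 * C 1 = 1 := by simp only [hC]; exact_mod_cast hc3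
  obtain ⟨t, ht⟩ : ∃ t : Fin 3 → ℝ, ∀ i, t i = (Apollonian.form (Apollonian.α i.succ) s).re :=
    ⟨_, fun _ => rfl⟩
  have hmem := Apollonian.mem_siegelH_iff hs hZ ht
  have hexp := Complex.exp_ne_zero (Apollonian.form C s)
  refine ⟨fun hZmem => ?_, fun hR => ?_⟩
  · obtain ⟨ht1, ht2⟩ := hmem.1 hZmem
    have hn := Apollonian.summable_denomCoeff ht ht1 ht2
    have hf := Apollonian.summable_fourierCoeff ht ht1 ht2
    refine ⟨(Apollonian.summable_deltaTerm_iff hs hZ).2 hf,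
      (Apollonian.summable_altTerm_iff h1 h2 h3 s).2 hn,
      Apollonian.summable_multiplicity_mul_altTerm h1 h2 h3 hf, ?_, fun hq hne => ?_⟩
    · rw [Apollonian.exp_mul_altSum_sub h1 h2 h3 hf, Apollonian.exp_mul_Delta5 hs hZ]
    · have hmul := Apollonian.tsum_mul_tsum_latticeExp Apollonian.nonneg_of_denomCoeff_ne_zero
        (fun a ha => Apollonian.nonneg_of_quotCoeff_ne_zero ha)
        Apollonian.finsum_mul_quotientCoeff hn ((Apollonian.summable_quotientCoeff_iff s).1 hq)
      rw [← Apollonian.exp_mul_altSum h1 h2 h3, ← Apollonian.tsum_quotientCoeff,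
        Apollonian.tsum_numerCoeff, ← Apollonian.exp_mul_Delta5 hs hZ] at hmul
      rw [div_eq_iff (by simp [hexp, hne])]
      linear_combination -64 * hmul
  · have ht3 : ∀ i, 3 < t i := fun i => (hR i).trans_eq (ht i).symm
    have p0 : 0 < t 0 := by linarith [ht3 0]
    have p1 : 0 < t 1 := by linarith [ht3 1]
    have p2 : 0 < t 2 := by linarith [ht3 2]
    have ht1 : 0 < t 0 + t 2 := by positivity
    have ht2 : 0 < t 0 * t 1 + t 0 * t 2 + t 1 * t 2 := by positivity
    refine ⟨hmem.2 ⟨ht1, ht2⟩, fun h => ?_, Apollonian.summable_quotientCoeff_of_lt hR⟩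
    refine Apollonian.tsum_denomCoeff_ne_zero_of_lt hR
      (Apollonian.summable_denomCoeff ht ht1 ht2) ?_
    rw [← Apollonian.exp_mul_altSum h1 h2 h3, h, mul_zero]
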